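/- Let $W:\{0,1\}\to\mathcal Y$ be a binary-input discrete memoryless channel with finite output alphabet that is symmetric, i.e. there is a permutation $\pi=\pi^{-1}$ of $\mathcal Y$ with $W(y\mid 0)=W(\pi(y)\mid 1)$ for all $y$. Let $I(W)$ be the mutual information (in bits) between a uniform input and the output of $W$, and let $Z(W)=\sum_{y}\sqrt{W(y\mid 0)W(y\mid 1)}$. Let $G$ be an invertible $\ell\times\ell$ matrix over $\mathrm{GF}(2)$. For an $N\times N$ matrix $M$ over $\mathrm{GF}(2)$ and $1\le i\le N$, let $W_M^{(i)}$ be the channel with input $u_i$, output $(y_1^N,u_1^{i-1})$ and transition probabilities $$W_M^{(i)}(y_1^N,u_1^{i-1}\mid u_i)=\frac1{2^{N-1}}\sum_{u_{i+1}^N}\prod_{j=1}^N W\big(y_j\mid (u_1^N M)_j\big),$$ and let $\tilde W_M^{(i)}(y_1^N\mid u_i)=2^{-(N-i)}\sum_{u_{i+1}^N}\prod_{j=1}^N W\big(y_j\mid ((0_1^{i-1},u_i^N)M)_j\big)$. For $n\ge 0$ and $1\le i\le\ell^n$ let $W^{(i)}$ denote $W_M^{(i)}$ with $N=\ell^n$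 and $M=A_nG^{\otimes n}$, where $A_n$ is the permutation matrix on $\{1,\dots,\ell^n\}$ that reverses base-$\ell$ digits (of the index minus one). Call $G$ polarizing (for $W$) if there are $i\in\{1,\dots,\ell\}$, $A\subseteq\{1,\dots,\ell\}$ with $|A|\ge 2$ and a probability distribution $Q$ on $\mathcal Y^{A^c}$ with $\tilde W_G^{(i)}(y_1^\ell\mid u_i)=Q(y_{A^c})\prod_{j\in A}W(y_j\mid u_i)$ for all $y_1^\ell$ and $u_i$. If no column permutation makes $G$ upper triangular, then $G$ is polarizing; if $I(W)>0$, the converse holds too. Moreover: (i) If $G$ is polarizing, then for every $\delta>0$ $$\lim_{n\to\infty}\frac{|\{i: I(W^{(i)})\in(\delta,1-\delta)\}|}{\ell^n}=0,\qquad \lim_{n\to\infty}\frac{|\{i: Z(W^{(i)})\in(\delta,1-\delta)\}|}{\ell^n}=0,$$ and the limiting fraction of noiseless channels is $I(W)$: for every $\delta\in(0,1)$ $$\lim_{n\to\infty}\frac{|\{i: I(W^{(i)})\ge 1-\delta\}|}{\ell^n}=\lim_{n\to\infty}\frac{|\{i: Z(W^{(i)})\le\delta\}|}{\ell^n}=I(W).$$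 (ii) If $G$ is not polarizing, or if some column permutation makes $G$ upper triangular, then $I(W^{(i)})=I(W)$ and $Z(W^{(i)})=Z(W)$ for all $n$ and all $i\in\{1,\dots,\ell^n\}$. -/

import Mathlib

open scoped Matrix

noncomputable section

/-- `W x y` is the transition probability `W(y | x)` of a binary-input discrete memoryless channel
with finite output alphabet `Y`; the input alphabet `{0, 1}` is `ZMod 2`. -/
structure IsBDMC {Y : Type*} [Fintype Y] (W : ZMod 2 → Y → ℝ) : Prop where
  nonneg : ∀ x y, 0 ≤ W x y
  sum_eq_one : ∀ x, ∑ y, W x y = 1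

/-- Symmetric channel: some involution of the output alphabet exchanges the two inputs. -/
def IsSymmetricChannel {Y : Type*} (W : ZMod 2 → Y → ℝ) : Prop :=
  ∃ π : Equiv.Perm Y, π = π⁻¹ ∧ ∀ y, W 0 y = W 1 (π y)

/-- Mutual information (in bits) between the uniformly distributed input and the output.
A term with `W x y = 0` is `0`, so divisions by zero never contribute. -/
def mutualInfo {Y : Type*} [Fintype Y] (W : ZMod 2 → Y → ℝ) : ℝ :=
  ∑ x : ZMod 2, ∑ y, (1 / 2) * W x y * Real.logb 2 (W x y / ((1 / 2) * W 0 y + (1 / 2) * W 1 y))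

/-- Bhattacharyya parameter. -/
def bhattacharyya {Y : Type*} [Fintype Y] (W : ZMod 2 → Y → ℝ) : ℝ :=
  ∑ y, √(W 0 y * W 1 y)

/-- The vector channel: `u` is encoded as the row vector `u M` over GF(2), whose entries are sent
through independent uses of `W`. -/
def vectorChannel {Y : Type*} {N : ℕ} (W : ZMod 2 → Y → ℝ)
    (M : Matrix (Fin N) (Fin N) (ZMod 2)) (u : Fin N → ZMod 2) (y : Fin N → Y) : ℝ :=
  ∏ j, W ((u ᵥ* M) j) (y j)

/-- The channel with input `u_i` and output `(y, (u_j)_{j < i})` defined by the matrix `M`: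
`2^{-(N-1)}` times the sum of the vector channel over all later entries of `u`. -/
def synthChannel {Y : Type*} {N : ℕ} (W : ZMod 2 → Y → ℝ)
    (M : Matrix (Fin N) (Fin N) (ZMod 2)) (i : Fin N) :
    ZMod 2 → (Fin N → Y) × ({j : Fin N // j < i} → ZMod 2) → ℝ :=
  fun x o => (1 / 2 ^ (N - 1)) *
    ∑ u : Fin N → ZMod 2 with (∀ j : {j : Fin N // j < i}, u j = o.2 j) ∧ u i = x,
      vectorChannel W M u o.1

/-- The channel with input `u_i` and output `y` where all earlier entries of `u` are `0` and the
later ones are uniform. With indices starting at `0` there are `N - 1 - i` later entries. -/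
def zeroPastChannel {Y : Type*} {N : ℕ} (W : ZMod 2 → Y → ℝ)
    (M : Matrix (Fin N) (Fin N) (ZMod 2)) (i : Fin N) : ZMod 2 → (Fin N → Y) → ℝ :=
  fun x y => (1 / 2 ^ (N - 1 - (i : ℕ))) *
    ∑ u : Fin N → ZMod 2 with (∀ j, j < i → u j = 0) ∧ u i = x, vectorChannel W M u y

/-- `G` is polarizing (for `W`): some input bit sees at least two independent copies of `W`, while
the remaining outputs are independent of that bit. -/
def IsPolarizing {Y : Type*} [Fintype Y] {ℓ : ℕ} (W : ZMod 2 → Y → ℝ)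
    (G : Matrix (Fin ℓ) (Fin ℓ) (ZMod 2)) : Prop :=
  ∃ (i : Fin ℓ) (A : Finset (Fin ℓ)) (Q : ({j : Fin ℓ // j ∉ A} → Y) → ℝ),
    2 ≤ A.card ∧ (∀ z, 0 ≤ Q z) ∧ ∑ z, Q z = 1 ∧
    ∀ (x : ZMod 2) (y : Fin ℓ → Y),
      zeroPastChannel W G i x y = Q (fun j => y j) * ∏ j ∈ A, W x (y j)

/-- Some permutation of the columns of `G` makes it upper triangular. -/
def HasUpperTriangularColumnPerm {ℓ : ℕ} (G : Matrix (Fin ℓ) (Fin ℓ) (ZMod 2)) : Prop :=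
  ∃ σ : Equiv.Perm (Fin ℓ), (G.submatrix id σ).BlockTriangular id

/-- The Kronecker power `G^{⊗n}`, indexed by `0, …, ℓ^n - 1` through base-`ℓ` digits. -/
def kroneckerPow {ℓ : ℕ} (G : Matrix (Fin ℓ) (Fin ℓ) (ZMod 2)) (n : ℕ) :
    Matrix (Fin (ℓ ^ n)) (Fin (ℓ ^ n)) (ZMod 2) :=
  Matrix.of fun a b => ∏ k : Fin n, G (finFunctionFinEquiv.symm a k) (finFunctionFinEquiv.symm b k)

/-- The permutation of `0, …, ℓ^n - 1` that reverses the `n` base-`ℓ` digits. -/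
def digitReversal (ℓ n : ℕ) : Equiv.Perm (Fin (ℓ ^ n)) :=
  (finFunctionFinEquiv.symm.trans (Equiv.arrowCongr Fin.revPerm (Equiv.refl (Fin ℓ)))).trans
    finFunctionFinEquiv

/-- The matrix `A_n G^{⊗n}`, with `A_n` the digit-reversal permutation matrix. -/
def polarTransform {ℓ : ℕ} (G : Matrix (Fin ℓ) (Fin ℓ) (ZMod 2)) (n : ℕ) :
    Matrix (Fin (ℓ ^ n)) (Fin (ℓ ^ n)) (ZMod 2) :=
  (digitReversal ℓ n).permMatrix (ZMod 2) * kroneckerPow G n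

/-- `I(W^{(i)})` for the `i`-th channel defined by `A_n G^{⊗n}`. -/
def polarI {Y : Type*} [Fintype Y] {ℓ : ℕ} (W : ZMod 2 → Y → ℝ)
    (G : Matrix (Fin ℓ) (Fin ℓ) (ZMod 2)) (n : ℕ) (i : Fin (ℓ ^ n)) : ℝ :=
  mutualInfo (synthChannel W (polarTransform G n) i)

/-- `Z(W^{(i)})` for the `i`-th channel defined by `A_n G^{⊗n}`. -/
def polarZ {Y : Type*} [Fintype Y] {ℓ : ℕ} (W : ZMod 2 → Y → ℝ)
    (G : Matrix (Fin ℓ) (Fin ℓ) (ZMod 2)) (n : ℕ) (i : Fin (ℓ ^ n)) : ℝ :=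
  bhattacharyya (synthChannel W (polarTransform G n) i)

end

/-! The parameters `mutualInfo`, `bhattacharyya` and `meanSqBias` are sums over outputs of a
symmetric, degree-one homogeneous function of the two likelihoods (`IsKernel`). Such sums ignore
relabelled inputs and common factors of the likelihoods. Hence the channels of level `n + 1` have
the same parameters as those obtained by applying `G` once to ℓ copies of a channel of level `n`
(`channelSum_polarTransform_succ`).

One application of `G` is governed by its rows below row `i`. Suppose they are supported on a set
`C` of as many columns (`IsLowerSupport`). By invertibility they randomize the symbols on `C`
completely, and outside `C` the input bit is seen exactly where row `i` has a one
(`IsLowerSupport.prefixAverage_update`). Eliminating rows from the bottom either reaches a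
triangular form, where each row has a single one outside its `C` and every parameter is preserved,
or stops at a row with two such ones (`hasUpperTriangularColumnPerm_or_exists`). The latter row
witnesses polarization and gives two independent looks at the bit. A triangular matrix can be
polarizing only if the two laws `W 0` and `W 1` agree, that is, if the information vanishes.

The second look has a quantitative gain (`IsBDMC.mutualInfo_add_le`). Mutual information remains
convex in the posterior after a quarter of the squared bias is subtracted from it (in nats), so it
gains at least a quarter of what the bias gains, and the gain of the bias is explicit. It is bounded
below when the information lies in `[δ, 1 - δ]` (`IsBDMC.gain_lower_bound`).

By the chain rule (`sum_mutualInfo_synthChannel`) the information is a martingale along the digits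
of the index. Its second moment is bounded, and it increases by at least a constant times the
fraction of undecided channels, so that fraction tends to zero. Since the mean stays `mutualInfo W`
and almost all values are near 0 or 1, the fraction near 1 tends to this mean. Statements on the
Bhattacharyya parameter follow by comparing both parameters with the mean square bias. -/

open scoped BigOperators

/-! ### Channel functionals given by homogeneous kernels -/

/-- `∑ y, φ (W 0 y) (W 1 y)`. -/
noncomputable def channelSum {Y : Type*} [Fintype Y] (φ : ℝ → ℝ → ℝ) (W : ZMod 2 → Y → ℝ) : ℝ :=
  ∑ y, φ (W 0 y) (W 1 y)

/-- Symmetric functions on the nonnegative quadrant that are homogeneous of degree one. -/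
structure IsKernel (φ : ℝ → ℝ → ℝ) : Prop where
  symm : ∀ a b, φ a b = φ b a
  homog : ∀ t a b, 0 ≤ t → 0 ≤ a → 0 ≤ b → φ (t * a) (t * b) = t * φ a b

/-- The kernel of the mutual information. -/
noncomputable def infoKernel (a b : ℝ) : ℝ :=
  (1 / 2) * a * Real.logb 2 (a / ((1 / 2) * a + (1 / 2) * b)) +
    (1 / 2) * b * Real.logb 2 (b / ((1 / 2) * a + (1 / 2) * b))

/-- The kernel of the Bhattacharyya parameter. -/
noncomputable def bhattKernel (a b : ℝ) : ℝ := √(a * b)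

/-- The kernel of the mean square bias of the posterior. -/
noncomputable def biasKernel (a b : ℝ) : ℝ := (a - b) ^ 2 / (2 * (a + b))

/-- Mean square bias of the posterior distribution of a uniform input. -/
noncomputable def meanSqBias {Y : Type*} [Fintype Y] (W : ZMod 2 → Y → ℝ) : ℝ :=
  channelSum biasKernel W

lemma mutualInfo_eq_channelSum {Y : Type*} [Fintype Y] (W : ZMod 2 → Y → ℝ) :
    mutualInfo W = channelSum infoKernel W := by
  unfold mutualInfo channelSum infoKernel
  rw [Finset.sum_comm]
  refine Finset.sum_congr rfl fun y _ => ?_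
  exact Fin.sum_univ_two _

lemma isKernel_infoKernel : IsKernel infoKernel where
  symm a b := by
    unfold infoKernel
    rw [add_comm ((1 / 2) * a) ((1 / 2) * b), add_comm]
  homog t a b ht _ _ := by
    unfold infoKernel
    rcases ht.eq_or_lt with rfl | ht
    · simp
    have h : (1 / 2) * (t * a) + (1 / 2) * (t * b) = t * ((1 / 2) * a + (1 / 2) * b) := by ring
    rw [h, mul_div_mul_left _ _ ht.ne', mul_div_mul_left _ _ ht.ne']
    ring

lemma isKernel_bhattKernel : IsKernel bhattKernel where
  symm a b := by unfold bhattKernel; rw [mul_comm]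
  homog t a b ht _ _ := by
    unfold bhattKernel
    rw [show t * a * (t * b) = t ^ 2 * (a * b) by ring, Real.sqrt_mul (sq_nonneg t),
      Real.sqrt_sq ht]

lemma isKernel_biasKernel : IsKernel biasKernel where
  symm a b := by unfold biasKernel; rw [add_comm, ← neg_sq, neg_sub]
  homog t a b ht _ _ := by
    unfold biasKernel
    rcases ht.eq_or_lt with rfl | ht
    · simp
    rw [show (t * a - t * b) ^ 2 = t * (t * (a - b) ^ 2) by ring,
      show 2 * (t * a + t * b) = t * (2 * (a + b)) by ring, mul_div_mul_left _ _ ht.ne', mul_div_assoc]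

/-! ### Kernels in terms of the posterior -/

/-- Here `a / (a + b)` is the posterior of the input 0 and `(a + b) / 2` the output probability.
When both likelihoods vanish the conventions for division by zero make both sides zero. -/
lemma infoKernel_eq {a b : ℝ} (ha : 0 ≤ a) (hb : 0 ≤ b) :
    infoKernel a b =
      (a + b) / 2 * ((Real.log 2 - Real.binEntropy (a / (a + b))) / Real.log 2) := by
  rcases (add_nonneg ha hb).eq_or_lt with h | h
  · have ha0 : a = 0 := by linarith
    have hb0 : b = 0 := by linarith
    simp [ha0, hb0, infoKernel]
  have hL : Real.log 2 ≠ 0 := (Real.log_pos one_lt_two).ne'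
  have key : ∀ x, 0 ≤ x → x * Real.log (x / ((1 / 2) * a + (1 / 2) * b)) =
      x * Real.log 2 + (a + b) * (x / (a + b) * Real.log (x / (a + b))) := by
    intro x hx
    rcases hx.eq_or_lt with rfl | hx
    · simp
    rw [show x / ((1 / 2) * a + (1 / 2) * b) = 2 * (x / (a + b)) by field_simp,
      Real.log_mul two_ne_zero (by positivity)]
    field_simp
  have hq : 1 - a / (a + b) = b / (a + b) := by field_simp; ring
  have ka := key a ha
  have kb := key b hb
  rw [Real.binEntropy, hq, Real.log_inv, Real.log_inv]
  unfold infoKernel Real.logb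
  field_simp at ka kb ⊢
  linarith

lemma biasKernel_eq {a b : ℝ} (ha : 0 ≤ a) (hb : 0 ≤ b) :
    biasKernel a b = (a + b) / 2 * (2 * (a / (a + b)) - 1) ^ 2 := by
  rcases (add_nonneg ha hb).eq_or_lt with h | h
  · have ha0 : a = 0 := by linarith
    have hb0 : b = 0 := by linarith
    simp [ha0, hb0, biasKernel]
  unfold biasKernel
  field_simp
  ring

lemma bhattKernel_eq {a b : ℝ} (ha : 0 ≤ a) (hb : 0 ≤ b) :
    bhattKernel a b = (a + b) / 2 * (2 * √(a / (a + b) * (1 - a / (a + b)))) := by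
  rcases (add_nonneg ha hb).eq_or_lt with h | h
  · have ha0 : a = 0 := by linarith
    have hb0 : b = 0 := by linarith
    simp [ha0, hb0, bhattKernel]
  have hq : a / (a + b) * (1 - a / (a + b)) = a * b / (a + b) ^ 2 := by field_simp; ring
  rw [hq, Real.sqrt_div' _ (sq_nonneg _), Real.sqrt_sq h.le]
  unfold bhattKernel
  field_simp

/-! ### Estimates for the binary entropy -/

lemma mul_sub_one_le_mul_log {x : ℝ} (hx : 0 ≤ x) : x - 1 ≤ x * Real.log x := by
  rcases hx.eq_or_lt with rfl | hx
  · simp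
  have h := Real.log_le_sub_one_of_pos (inv_pos.2 hx)
  rw [Real.log_inv] at h
  have := mul_le_mul_of_nonneg_left h hx.le
  have h2 : x * (x⁻¹ - 1) = 1 - x := by field_simp
  linarith

lemma mul_log_le_mul_sub_one {x : ℝ} (hx : 0 ≤ x) : x * Real.log x ≤ x * (x - 1) := by
  rcases hx.eq_or_lt with rfl | hx
  · simp
  exact mul_le_mul_of_nonneg_left (Real.log_le_sub_one_of_pos hx) hx.le

lemma binEntropy_eq_neg (p : ℝ) :
    Real.binEntropy p = -(p * Real.log p) - (1 - p) * Real.log (1 - p) := by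
  rw [Real.binEntropy, Real.log_inv, Real.log_inv]; ring

lemma two_mul_mul_le_binEntropy {p : ℝ} (h0 : 0 ≤ p) (h1 : p ≤ 1) :
    2 * (p * (1 - p)) ≤ Real.binEntropy p := by
  rw [binEntropy_eq_neg]
  have h2 := mul_log_le_mul_sub_one h0
  have h3 := mul_log_le_mul_sub_one (sub_nonneg.2 h1)
  linarith

/-- The bound `x - 1 ≤ x * log x` taken at `√x` gives `2x - 2√x ≤ x log x`. Adding this for `p` and
`1 - p` leaves an inequality between square roots, `h6`, which is clear after squaring. -/
lemma binEntropy_le_two_mul_sqrt {p : ℝ} (h0 : 0 ≤ p) (h1 : p ≤ 1) :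
    Real.binEntropy p ≤ 2 * √(p * (1 - p)) := by
  have key : ∀ x, 0 ≤ x → 2 * x - 2 * √x ≤ x * Real.log x := by
    intro x hx
    have h := mul_sub_one_le_mul_log (Real.sqrt_nonneg x)
    rw [Real.log_sqrt hx] at h
    have h2 := mul_le_mul_of_nonneg_left h (Real.sqrt_nonneg x)
    have h3 := Real.mul_self_sqrt hx
    have h4 : √x * (√x * (Real.log x / 2)) = x * Real.log x / 2 := by rw [← mul_assoc, h3]; ring
    nlinarith
  have h2 := key p h0
  have h3 := key (1 - p) (sub_nonneg.2 h1)
  rw [binEntropy_eq_neg, Real.sqrt_mul h0]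
  have h4 := Real.sq_sqrt h0
  have h5 := Real.sq_sqrt (sub_nonneg.2 h1)
  have h6 : √p + √(1 - p) ≤ 1 + √p * √(1 - p) := by
    have : 0 ≤ √p * √(1 - p) := by positivity
    refine abs_le_of_sq_le_sq' ?_ (by positivity) |>.2
    nlinarith
  linarith

/-- The left side is the divergence of `(p, 1 - p)` from the uniform law, bounded by the chi-square
distance through `log (2x) ≤ 2x - 1`. -/
lemma log_two_sub_binEntropy_le {p : ℝ} (h0 : 0 ≤ p) (h1 : p ≤ 1) :
    Real.log 2 - Real.binEntropy p ≤ (2 * p - 1) ^ 2 := by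
  have key : ∀ x, 0 ≤ x → x * Real.log x + x * Real.log 2 ≤ x * (2 * x - 1) := by
    intro x hx
    rcases hx.eq_or_lt with rfl | hx
    · simp
    have h := Real.log_le_sub_one_of_pos (mul_pos two_pos hx)
    rw [Real.log_mul two_ne_zero hx.ne'] at h
    nlinarith
  have h2 := key p h0
  have h3 := key (1 - p) (sub_nonneg.2 h1)
  rw [binEntropy_eq_neg]
  nlinarith

/-- The second derivative is `1 / x - 1`, which is nonnegative on the unit interval. -/
lemma convexOn_mul_log_sub_sq :
    ConvexOn ℝ (Set.Icc 0 1) fun x : ℝ => x * Real.log x - x ^ 2 / 2 := by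
  refine MonotoneOn.convexOn_of_deriv (convex_Icc 0 1)
    (Real.continuous_mul_log.sub (by fun_prop)).continuousOn ?_ ?_
  · rw [interior_Icc]
    intro x hx
    exact ((Real.hasDerivAt_mul_log hx.1.ne').differentiableAt.sub
      (by fun_prop)).differentiableWithinAt
  · rw [interior_Icc]
    have hd : ∀ x ∈ Set.Ioo (0 : ℝ) 1,
        deriv (fun x : ℝ => x * Real.log x - x ^ 2 / 2) x = Real.log x + 1 - x := by
      intro x hx
      have h1 := (Real.hasDerivAt_mul_log hx.1.ne').sub (((hasDerivAt_id x).pow 2).div_const 2)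
      refine h1.deriv.trans ?_
      simp
    intro x hx y hy hxy
    rw [hd x hx, hd y hy]
    have h := Real.log_le_sub_one_of_pos (div_pos hx.1 hy.1)
    rw [Real.log_div hx.1.ne' hy.1.ne'] at h
    have h2 : x / y - 1 ≤ x - y := by
      rw [div_sub_one hy.1.ne', div_le_iff₀ hy.1]
      nlinarith [hy.2, hy.1]
    linarith

lemma convexOn_neg_binEntropy_sub_sq :
    ConvexOn ℝ (Set.Icc 0 1) fun p : ℝ =>
      (Real.log 2 - Real.binEntropy p) - (2 * p - 1) ^ 2 / 4 := by
  have h1 := convexOn_mul_log_sub_sq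
  have h2 : ConvexOn ℝ (Set.Icc 0 1)
      fun x : ℝ => (1 - x) * Real.log (1 - x) - (1 - x) ^ 2 / 2 := by
    refine ⟨convex_Icc 0 1, fun x hx y hy a b ha hb hab => ?_⟩
    have := h1.2 (x := 1 - x) (y := 1 - y) ⟨by linarith [hx.2], by linarith [hx.1]⟩
      ⟨by linarith [hy.2], by linarith [hy.1]⟩ ha hb hab
    have e : a • (1 - x) + b • (1 - y) = 1 - (a • x + b • y) := by
      simp only [smul_eq_mul]; linear_combination hab
    rw [e] at this
    exact this
  -- The squares add up to `p ^ 2 / 2 + (1 - p) ^ 2 / 2 = 1 / 4 + (2 * p - 1) ^ 2 / 4`, whence the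
  -- constant.
  have h3 := (h1.add h2).add_const (Real.log 2 + 1 / 4)
  refine h3.congr fun p _ => ?_
  simp only [Pi.add_apply]
  rw [binEntropy_eq_neg]
  ring

/-- The convex function of `convexOn_neg_binEntropy_sub_sq` is invariant under `p ↦ 1 - p` and
vanishes at `1 / 2`, so its minimum is zero. -/
lemma sq_div_four_le_log_two_sub_binEntropy {p : ℝ} (h0 : 0 ≤ p) (h1 : p ≤ 1) :
    (2 * p - 1) ^ 2 / 4 ≤ Real.log 2 - Real.binEntropy p := by
  have hp : p ∈ Set.Icc (0 : ℝ) 1 := ⟨h0, h1⟩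
  have hq : 1 - p ∈ Set.Icc (0 : ℝ) 1 := ⟨by linarith, by linarith⟩
  have h := convexOn_neg_binEntropy_sub_sq.2 hp hq (show (0 : ℝ) ≤ 1 / 2 by norm_num)
    (show (0 : ℝ) ≤ 1 / 2 by norm_num) (by norm_num)
  simp only [smul_eq_mul, Real.binEntropy_one_sub] at h
  rw [show (1 / 2 : ℝ) * p + 1 / 2 * (1 - p) = 2⁻¹ by ring, Real.binEntropy_two_inv] at h
  nlinarith

/-! ### Subadditivity -/

/-- Jensen's inequality at the posteriors `a k / (a k + b k)` with weights proportional to `a k + b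
k`: merging outputs averages their posteriors. -/
lemma perspective_sum_le {g : ℝ → ℝ} (hg : ConvexOn ℝ (Set.Icc 0 1) g) {ι : Type*} (s : Finset ι)
    (a b : ι → ℝ) (ha : ∀ k ∈ s, 0 ≤ a k) (hb : ∀ k ∈ s, 0 ≤ b k) :
    (∑ k ∈ s, a k + ∑ k ∈ s, b k) * g ((∑ k ∈ s, a k) / (∑ k ∈ s, a k + ∑ k ∈ s, b k)) ≤
      ∑ k ∈ s, (a k + b k) * g (a k / (a k + b k)) := by
  rw [← Finset.sum_add_distrib]
  set S := ∑ k ∈ s, (a k + b k) with hS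
  have hnn : ∀ k ∈ s, 0 ≤ a k + b k := fun k hk => add_nonneg (ha k hk) (hb k hk)
  rcases (Finset.sum_nonneg hnn).eq_or_lt with h | h
  · have hz := (Finset.sum_eq_zero_iff_of_nonneg hnn).1 h.symm
    rw [hS, ← h, zero_mul]
    exact (Finset.sum_eq_zero fun k hk => by rw [hz k hk, zero_mul]).ge
  · have hj := hg.map_sum_le (t := s) (w := fun k => (a k + b k) / S)
      (p := fun k => a k / (a k + b k)) (fun k hk => div_nonneg (hnn k hk) h.le)
      (by rw [← Finset.sum_div, div_self h.ne'])
      (fun k hk => ⟨div_nonneg (ha k hk) (hnn k hk),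
        div_le_one_of_le₀ (by linarith [hb k hk]) (hnn k hk)⟩)
    simp only [smul_eq_mul] at hj
    have e : ∑ k ∈ s, (a k + b k) / S * (a k / (a k + b k)) = (∑ k ∈ s, a k) / S := by
      rw [Finset.sum_div]
      refine Finset.sum_congr rfl fun k hk => ?_
      rcases (hnn k hk).eq_or_lt with h0 | h0
      · have : a k = 0 := by linarith [ha k hk, hb k hk]
        simp [this]
      · field_simp
    rw [e] at hj
    calc S * g ((∑ k ∈ s, a k) / S)
        ≤ S * ∑ k ∈ s, (a k + b k) / S * g (a k / (a k + b k)) :=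
          mul_le_mul_of_nonneg_left hj h.le
      _ = _ := by
          rw [Finset.mul_sum]
          refine Finset.sum_congr rfl fun k _ => ?_
          rw [← mul_assoc, mul_div_cancel₀ _ (ne_of_gt h)]

/-- The mutual information kernel is more than subadditive: a multiple of the bias kernel can be
subtracted from it. -/
lemma infoKernel_sub_biasKernel_sum_le {ι : Type*} (s : Finset ι)
    (a b : ι → ℝ) (ha : ∀ k ∈ s, 0 ≤ a k) (hb : ∀ k ∈ s, 0 ≤ b k) :
    infoKernel (∑ k ∈ s, a k) (∑ k ∈ s, b k) +
        (∑ k ∈ s, biasKernel (a k) (b k) - biasKernel (∑ k ∈ s, a k) (∑ k ∈ s, b k)) / 4 ≤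
      ∑ k ∈ s, infoKernel (a k) (b k) := by
  have hL : 0 < Real.log 2 := Real.log_pos one_lt_two
  have hL1 : Real.log 2 ≤ 1 := by linarith [Real.log_two_lt_d9]
  have hc := perspective_sum_le convexOn_neg_binEntropy_sub_sq s a b ha hb
  have hb2 : biasKernel (∑ k ∈ s, a k) (∑ k ∈ s, b k) ≤ ∑ k ∈ s, biasKernel (a k) (b k) := by
    have hq : ConvexOn ℝ (Set.Icc 0 1) fun p : ℝ => (2 * p - 1) ^ 2 := by
      refine ⟨convex_Icc 0 1, fun x _ y _ u v hu hv huv => ?_⟩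
      obtain rfl : v = 1 - u := by linarith
      simp only [smul_eq_mul]
      nlinarith [mul_nonneg (mul_nonneg hu hv) (sq_nonneg (x - y))]
    have := perspective_sum_le hq s a b ha hb
    rw [biasKernel_eq (Finset.sum_nonneg ha) (Finset.sum_nonneg hb),
      Finset.sum_congr rfl fun k hk => biasKernel_eq (ha k hk) (hb k hk)]
    simp only [div_mul_eq_mul_div, ← Finset.sum_div]
    linarith
  have e : ∀ x y : ℝ, 0 ≤ x → 0 ≤ y → (x + y) * ((Real.log 2 - Real.binEntropy (x / (x + y))) -
      (2 * (x / (x + y)) - 1) ^ 2 / 4) =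
        2 * Real.log 2 * infoKernel x y - biasKernel x y / 2 := by
    intro x y hx hy
    rw [infoKernel_eq hx hy, biasKernel_eq hx hy]
    field_simp
    ring
  rw [e _ _ (Finset.sum_nonneg ha) (Finset.sum_nonneg hb),
    Finset.sum_congr rfl fun k hk => e _ _ (ha k hk) (hb k hk), Finset.sum_sub_distrib,
    ← Finset.mul_sum, ← Finset.sum_div] at hc
  set A := infoKernel (∑ k ∈ s, a k) (∑ k ∈ s, b k)
  set B := ∑ k ∈ s, infoKernel (a k) (b k)
  set D := ∑ k ∈ s, biasKernel (a k) (b k) - biasKernel (∑ k ∈ s, a k) (∑ k ∈ s, b k)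
  have hD : 0 ≤ D := by linarith
  -- Nonnegativity of `D` forces `B - A` to be nonnegative, and only then may the factor `log 2 ≤ 1`
  -- be dropped.
  have h1 : D ≤ 4 * (Real.log 2 * (B - A)) := by linarith
  have h2 : 0 ≤ Real.log 2 * (B - A) := by linarith
  have h3 : 0 ≤ B - A := by
    by_contra hneg
    nlinarith
  nlinarith

/-- Data processing: merging outputs cannot raise the information. -/
lemma infoKernel_sum_le {ι : Type*} (s : Finset ι)
    (a b : ι → ℝ) (ha : ∀ k ∈ s, 0 ≤ a k) (hb : ∀ k ∈ s, 0 ≤ b k) :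
    infoKernel (∑ k ∈ s, a k) (∑ k ∈ s, b k) ≤ ∑ k ∈ s, infoKernel (a k) (b k) := by
  have hL : 0 < Real.log 2 := Real.log_pos one_lt_two
  have hc : ConvexOn ℝ (Set.Icc 0 1) fun p : ℝ =>
      2⁻¹ * (Real.log 2)⁻¹ * (Real.log 2 - Real.binEntropy p) := by
    have h := Real.strictConcave_binEntropy.concaveOn.neg.add_const (Real.log 2)
    refine (h.smul (c := 2⁻¹ * (Real.log 2)⁻¹) (by positivity)).congr fun p _ => ?_
    simp only [Pi.add_apply, Pi.neg_apply, smul_eq_mul]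
    ring
  have h := perspective_sum_le hc s a b ha hb
  have e : ∀ x y : ℝ, 0 ≤ x → 0 ≤ y → (x + y) * (2⁻¹ * (Real.log 2)⁻¹ *
      (Real.log 2 - Real.binEntropy (x / (x + y)))) = infoKernel x y := by
    intro x y hx hy
    rw [infoKernel_eq hx hy]
    field_simp
  rwa [e _ _ (Finset.sum_nonneg ha) (Finset.sum_nonneg hb),
    Finset.sum_congr rfl fun k hk => e _ _ (ha k hk) (hb k hk)] at h

/-! ### Comparison of the channel parameters -/

section Parameters

variable {Y : Type*} [Fintype Y] {W : ZMod 2 → Y → ℝ}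

lemma IsBDMC.sum_half (hW : IsBDMC W) : ∑ y, (W 0 y + W 1 y) / 2 = 1 := by
  rw [← Finset.sum_div, Finset.sum_add_distrib, hW.sum_eq_one, hW.sum_eq_one]; norm_num

lemma IsBDMC.posterior_mem (hW : IsBDMC W) (y : Y) :
    0 ≤ W 0 y / (W 0 y + W 1 y) ∧ W 0 y / (W 0 y + W 1 y) ≤ 1 := by
  have h0 := hW.nonneg 0 y
  have h1 := hW.nonneg 1 y
  exact ⟨by positivity, div_le_one_of_le₀ (by linarith) (by linarith)⟩

lemma IsBDMC.half_nonneg (hW : IsBDMC W) (y : Y) : 0 ≤ (W 0 y + W 1 y) / 2 := by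
  linarith [hW.nonneg 0 y, hW.nonneg 1 y]

/-- Each parameter is the mean, under the output law, of a function of the posterior. Pointwise
inequalities between those functions thus become inequalities between parameters. -/
lemma IsBDMC.log_two_mul_mutualInfo (hW : IsBDMC W) :
    Real.log 2 * mutualInfo W = ∑ y, (W 0 y + W 1 y) / 2 *
      (Real.log 2 - Real.binEntropy (W 0 y / (W 0 y + W 1 y))) := by
  have hL : Real.log 2 ≠ 0 := (Real.log_pos one_lt_two).ne'
  rw [mutualInfo_eq_channelSum, channelSum, Finset.mul_sum]
  refine Finset.sum_congr rfl fun y _ => ?_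
  rw [infoKernel_eq (hW.nonneg 0 y) (hW.nonneg 1 y)]
  field_simp

lemma IsBDMC.log_two_mul_one_sub_mutualInfo (hW : IsBDMC W) :
    Real.log 2 * (1 - mutualInfo W) = ∑ y, (W 0 y + W 1 y) / 2 *
      Real.binEntropy (W 0 y / (W 0 y + W 1 y)) := by
  rw [mul_sub, hW.log_two_mul_mutualInfo]
  simp only [mul_sub, Finset.sum_sub_distrib]
  rw [← Finset.sum_mul, hW.sum_half]
  ring

lemma IsBDMC.meanSqBias_eq (hW : IsBDMC W) :
    meanSqBias W = ∑ y, (W 0 y + W 1 y) / 2 * (2 * (W 0 y / (W 0 y + W 1 y)) - 1) ^ 2 :=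
  Finset.sum_congr rfl fun y _ => biasKernel_eq (hW.nonneg 0 y) (hW.nonneg 1 y)

lemma IsBDMC.one_sub_meanSqBias_eq (hW : IsBDMC W) :
    1 - meanSqBias W = ∑ y, (W 0 y + W 1 y) / 2 *
      (4 * (W 0 y / (W 0 y + W 1 y) * (1 - W 0 y / (W 0 y + W 1 y)))) := by
  rw [hW.meanSqBias_eq]
  refine (congrArg (· - _) hW.sum_half.symm).trans ?_
  rw [← Finset.sum_sub_distrib]
  exact Finset.sum_congr rfl fun y _ => by ring

lemma IsBDMC.bhattacharyya_eq (hW : IsBDMC W) :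
    bhattacharyya W = ∑ y, (W 0 y + W 1 y) / 2 *
      (2 * √(W 0 y / (W 0 y + W 1 y) * (1 - W 0 y / (W 0 y + W 1 y)))) :=
  Finset.sum_congr rfl fun y _ => bhattKernel_eq (hW.nonneg 0 y) (hW.nonneg 1 y)

lemma IsBDMC.mutualInfo_nonneg (hW : IsBDMC W) : 0 ≤ mutualInfo W := by
  have hL : 0 < Real.log 2 := Real.log_pos one_lt_two
  refine (mul_nonneg_iff_of_pos_left hL).1 ?_
  rw [hW.log_two_mul_mutualInfo]
  exact Finset.sum_nonneg fun y _ => mul_nonneg (hW.half_nonneg y)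
    (sub_nonneg.2 Real.binEntropy_le_log_two)

lemma IsBDMC.mutualInfo_le_one (hW : IsBDMC W) : mutualInfo W ≤ 1 := by
  have hL : 0 < Real.log 2 := Real.log_pos one_lt_two
  rw [← sub_nonneg]
  refine (mul_nonneg_iff_of_pos_left hL).1 ?_
  rw [hW.log_two_mul_one_sub_mutualInfo]
  exact Finset.sum_nonneg fun y _ => mul_nonneg (hW.half_nonneg y)
    (Real.binEntropy_nonneg (hW.posterior_mem y).1 (hW.posterior_mem y).2)

lemma IsBDMC.meanSqBias_nonneg (hW : IsBDMC W) : 0 ≤ meanSqBias W := by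
  rw [hW.meanSqBias_eq]
  exact Finset.sum_nonneg fun y _ => mul_nonneg (hW.half_nonneg y) (sq_nonneg _)

lemma IsBDMC.mutualInfo_le (hW : IsBDMC W) : mutualInfo W ≤ 2 * meanSqBias W := by
  have hL : 1 / 2 < Real.log 2 := by linarith [Real.log_two_gt_d9]
  have h : Real.log 2 * mutualInfo W ≤ meanSqBias W := by
    rw [hW.log_two_mul_mutualInfo, hW.meanSqBias_eq]
    exact Finset.sum_le_sum fun y _ => mul_le_mul_of_nonneg_left
      (log_two_sub_binEntropy_le (hW.posterior_mem y).1 (hW.posterior_mem y).2) (hW.half_nonneg y)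
  nlinarith [hW.mutualInfo_nonneg]

lemma IsBDMC.meanSqBias_le (hW : IsBDMC W) : meanSqBias W ≤ 4 * mutualInfo W := by
  have hL : Real.log 2 < 1 := by linarith [Real.log_two_lt_d9]
  have h : meanSqBias W / 4 ≤ Real.log 2 * mutualInfo W := by
    rw [hW.log_two_mul_mutualInfo, hW.meanSqBias_eq, Finset.sum_div]
    refine Finset.sum_le_sum fun y _ => ?_
    rw [mul_div_assoc]
    exact mul_le_mul_of_nonneg_left (sq_div_four_le_log_two_sub_binEntropy
      (hW.posterior_mem y).1 (hW.posterior_mem y).2) (hW.half_nonneg y)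
  nlinarith [hW.mutualInfo_nonneg]

lemma IsBDMC.one_sub_meanSqBias_le (hW : IsBDMC W) :
    1 - meanSqBias W ≤ 2 * (1 - mutualInfo W) := by
  have hL : Real.log 2 < 1 := by linarith [Real.log_two_lt_d9]
  have h : (1 - meanSqBias W) / 2 ≤ Real.log 2 * (1 - mutualInfo W) := by
    rw [hW.log_two_mul_one_sub_mutualInfo, hW.one_sub_meanSqBias_eq, Finset.sum_div]
    refine Finset.sum_le_sum fun y _ => ?_
    rw [mul_div_assoc]
    refine mul_le_mul_of_nonneg_left ?_ (hW.half_nonneg y)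
    linarith [two_mul_mul_le_binEntropy (hW.posterior_mem y).1 (hW.posterior_mem y).2]
  nlinarith [hW.mutualInfo_le_one]

lemma IsBDMC.one_sub_mutualInfo_le (hW : IsBDMC W) :
    1 - mutualInfo W ≤ 2 * bhattacharyya W := by
  have hL : 1 / 2 < Real.log 2 := by linarith [Real.log_two_gt_d9]
  have h : Real.log 2 * (1 - mutualInfo W) ≤ bhattacharyya W := by
    rw [hW.log_two_mul_one_sub_mutualInfo, hW.bhattacharyya_eq]
    exact Finset.sum_le_sum fun y _ => mul_le_mul_of_nonneg_left
      (binEntropy_le_two_mul_sqrt (hW.posterior_mem y).1 (hW.posterior_mem y).2) (hW.half_nonneg y)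
  nlinarith [hW.mutualInfo_le_one]

/-- With `t = 2√(p(1 - p)) ∈ [0, 1]` the two sides average `t ^ 2` and `t`. -/
lemma IsBDMC.one_sub_meanSqBias_le_bhattacharyya (hW : IsBDMC W) :
    1 - meanSqBias W ≤ bhattacharyya W := by
  rw [hW.one_sub_meanSqBias_eq, hW.bhattacharyya_eq]
  refine Finset.sum_le_sum fun y _ => mul_le_mul_of_nonneg_left ?_ (hW.half_nonneg y)
  obtain ⟨h0, h1⟩ := hW.posterior_mem y
  set p := W 0 y / (W 0 y + W 1 y)
  have hp : 0 ≤ p * (1 - p) := mul_nonneg h0 (sub_nonneg.2 h1)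
  have h2 : √(p * (1 - p)) ≤ 1 / 2 := by
    rw [Real.sqrt_le_left (by norm_num)]
    nlinarith [sq_nonneg (2 * p - 1)]
  nlinarith [Real.mul_self_sqrt hp, Real.sqrt_nonneg (p * (1 - p))]

/-- Cauchy–Schwarz for the mean of `2√(p(1 - p))` under the output law. -/
lemma IsBDMC.bhattacharyya_sq_le (hW : IsBDMC W) :
    bhattacharyya W ^ 2 ≤ 1 - meanSqBias W := by
  rw [hW.one_sub_meanSqBias_eq, hW.bhattacharyya_eq]
  refine (Finset.sum_sq_le_sum_mul_sum_of_sq_le_mul Finset.univ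
    (f := fun y => (W 0 y + W 1 y) / 2)
    (g := fun y => (W 0 y + W 1 y) / 2 *
      (4 * (W 0 y / (W 0 y + W 1 y) * (1 - W 0 y / (W 0 y + W 1 y)))))
    (fun y _ => hW.half_nonneg y) (fun y _ => ?_) (fun y _ => le_of_eq ?_)).trans_eq ?_
  · have := hW.half_nonneg y
    have := mul_nonneg (hW.posterior_mem y).1 (sub_nonneg.2 (hW.posterior_mem y).2)
    positivity
  · rw [mul_pow, mul_pow, Real.sq_sqrt (mul_nonneg (hW.posterior_mem y).1
      (sub_nonneg.2 (hW.posterior_mem y).2))]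
    ring
  · rw [hW.sum_half, one_mul]

end Parameters

/-! ### Two independent looks at the input -/

/-- Put `m = aa' - bb'`, `S = aa' + bb'`, `t = (a - b) / (a + b)`. Then `m² / (2S)` exceeds its
tangent value `tm - t²S / 2` by `(m - tS)² / (2S)`, where `m - tS = 2ab(a' - b') / (a + b)`; finally
`S ≤ (a + b)(a' + b')`. Summed over the second output, the tangent terms reduce to `biasKernel a b`,
so the last term measures the gain. -/
lemma biasKernel_mul_ge {a b a' b' : ℝ} (ha : 0 ≤ a) (hb : 0 ≤ b) (ha' : 0 ≤ a') (hb' : 0 ≤ b') :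
    (a - b) / (a + b) * (a * a' - b * b') - (a - b) ^ 2 / (a + b) ^ 2 * ((a * a' + b * b') / 2) +
      4 * a ^ 2 * b ^ 2 / (a + b) ^ 3 * biasKernel a' b' ≤ biasKernel (a * a') (b * b') := by
  have h1 := mul_nonneg ha ha'
  have h2 := mul_nonneg hb hb'
  rcases (add_nonneg ha hb).eq_or_lt with h | h
  · have ha0 : a = 0 := by linarith
    have hb0 : b = 0 := by linarith
    simp [ha0, hb0, biasKernel]
  rcases (add_nonneg ha' hb').eq_or_lt with h' | h'
  · have ha0 : a' = 0 := by linarith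
    have hb0 : b' = 0 := by linarith
    simp [ha0, hb0, biasKernel]
  rcases (add_nonneg h1 h2).eq_or_lt with h'' | h''
  · have e1 : a * a' = 0 := by linarith
    have e2 : b * b' = 0 := by linarith
    have e3 : a = 0 ∨ b = 0 := by
      by_contra! hne
      have := (mul_eq_zero.1 e1).resolve_left hne.1
      have := (mul_eq_zero.1 e2).resolve_left hne.2
      linarith
    rw [e1, e2]
    rcases e3 with rfl | rfl <;> simp [biasKernel]
  · unfold biasKernel
    have key : (a * a' - b * b') ^ 2 / (2 * (a * a' + b * b')) -
        ((a - b) / (a + b) * (a * a' - b * b') -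
          (a - b) ^ 2 / (a + b) ^ 2 * ((a * a' + b * b') / 2)) =
        4 * a ^ 2 * b ^ 2 * (a' - b') ^ 2 / (2 * (a + b) ^ 2 * (a * a' + b * b')) := by
      field_simp
      ring
    have h3 : 4 * a ^ 2 * b ^ 2 / (a + b) ^ 3 * ((a' - b') ^ 2 / (2 * (a' + b'))) ≤
        4 * a ^ 2 * b ^ 2 * (a' - b') ^ 2 / (2 * (a + b) ^ 2 * (a * a' + b * b')) := by
      rw [div_mul_div_comm]
      refine div_le_div_of_nonneg_left (by positivity) (by positivity) ?_
      have : a * a' + b * b' ≤ (a + b) * (a' + b') := by nlinarith [mul_nonneg ha hb', mul_nonneg hb ha']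
      calc 2 * (a + b) ^ 2 * (a * a' + b * b') ≤ 2 * (a + b) ^ 2 * ((a + b) * (a' + b')) :=
            mul_le_mul_of_nonneg_left this (by positivity)
        _ = _ := by ring
    linarith

lemma IsBDMC.meanSqBias_add_le {Y Y' : Type*} [Fintype Y] [Fintype Y'] {V : ZMod 2 → Y → ℝ}
    {V' : ZMod 2 → Y' → ℝ} (hV : IsBDMC V) (hV' : IsBDMC V') :
    meanSqBias V + meanSqBias V' * (1 - meanSqBias V) ^ 2 / 2 ≤
      ∑ y, ∑ y', biasKernel (V 0 y * V' 0 y') (V 1 y * V' 1 y') := by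
  have h1 : ∀ y, biasKernel (V 0 y) (V 1 y) +
      4 * V 0 y ^ 2 * V 1 y ^ 2 / (V 0 y + V 1 y) ^ 3 * meanSqBias V' ≤
      ∑ y', biasKernel (V 0 y * V' 0 y') (V 1 y * V' 1 y') := by
    intro y
    have h := Finset.sum_le_sum fun y' (_ : y' ∈ Finset.univ) =>
      biasKernel_mul_ge (hV.nonneg 0 y) (hV.nonneg 1 y) (hV'.nonneg 0 y') (hV'.nonneg 1 y')
    refine le_trans (le_of_eq ?_) h
    rw [Finset.sum_add_distrib, Finset.sum_sub_distrib, ← Finset.mul_sum, ← Finset.mul_sum,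
      ← Finset.mul_sum, ← Finset.sum_div, Finset.sum_sub_distrib, Finset.sum_add_distrib,
      ← Finset.mul_sum, ← Finset.mul_sum, hV'.sum_eq_one, hV'.sum_eq_one]
    change _ = _ + _ * meanSqBias V'
    congr 1
    unfold biasKernel
    rcases eq_or_ne (V 0 y + V 1 y) 0 with h | h
    · simp [h]
    · field_simp
      ring
  -- Cauchy–Schwarz again: `1 - meanSqBias V` is the sum of `2ab / (a + b)`, whose square is the
  -- product of `(a + b) / 2` and `8a²b² / (a + b)³`.
  have h2 : (1 - meanSqBias V) ^ 2 / 2 ≤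
      ∑ y, 4 * V 0 y ^ 2 * V 1 y ^ 2 / (V 0 y + V 1 y) ^ 3 := by
    rw [div_le_iff₀ two_pos, Finset.sum_mul, hV.one_sub_meanSqBias_eq]
    refine (Finset.sum_sq_le_sum_mul_sum_of_sq_le_mul Finset.univ
      (f := fun y => (V 0 y + V 1 y) / 2)
      (g := fun y => 4 * V 0 y ^ 2 * V 1 y ^ 2 / (V 0 y + V 1 y) ^ 3 * 2)
      (fun y _ => hV.half_nonneg y) (fun y _ => ?_) (fun y _ => le_of_eq ?_)).trans_eq ?_
    · have h0 := hV.nonneg 0 y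
      have h1 := hV.nonneg 1 y
      positivity
    · rcases eq_or_ne (V 0 y + V 1 y) 0 with h | h
      · simp [h]
      · field_simp
        ring
    · rw [hV.sum_half, one_mul]
  calc _ ≤ meanSqBias V +
        (∑ y, 4 * V 0 y ^ 2 * V 1 y ^ 2 / (V 0 y + V 1 y) ^ 3) * meanSqBias V' := by
        nlinarith [hV'.meanSqBias_nonneg, mul_le_mul_of_nonneg_right h2 hV'.meanSqBias_nonneg]
    _ = ∑ y, (biasKernel (V 0 y) (V 1 y) +
          4 * V 0 y ^ 2 * V 1 y ^ 2 / (V 0 y + V 1 y) ^ 3 * meanSqBias V') := by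
        rw [Finset.sum_add_distrib, Finset.sum_mul]; rfl
    _ ≤ _ := Finset.sum_le_sum fun y _ => h1 y

/-- Quantitative gain from a second independent look at the input. -/
lemma IsBDMC.mutualInfo_add_le {Y Y' : Type*} [Fintype Y] [Fintype Y'] {V : ZMod 2 → Y → ℝ}
    {V' : ZMod 2 → Y' → ℝ} (hV : IsBDMC V) (hV' : IsBDMC V') :
    mutualInfo V + meanSqBias V' * (1 - meanSqBias V) ^ 2 / 8 ≤
      ∑ y, ∑ y', infoKernel (V 0 y * V' 0 y') (V 1 y * V' 1 y') := by
  have h1 : ∀ y, infoKernel (V 0 y) (V 1 y) +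
      (∑ y', biasKernel (V 0 y * V' 0 y') (V 1 y * V' 1 y') - biasKernel (V 0 y) (V 1 y)) / 4 ≤
      ∑ y', infoKernel (V 0 y * V' 0 y') (V 1 y * V' 1 y') := by
    intro y
    -- Forgetting the second output merges the pairs `(y, y')` with equal `y` and recovers `V`.
    have h := infoKernel_sub_biasKernel_sum_le Finset.univ (fun y' => V 0 y * V' 0 y')
      (fun y' => V 1 y * V' 1 y') (fun y' _ => mul_nonneg (hV.nonneg 0 y) (hV'.nonneg 0 y'))
      (fun y' _ => mul_nonneg (hV.nonneg 1 y) (hV'.nonneg 1 y'))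
    rwa [← Finset.mul_sum, ← Finset.mul_sum, hV'.sum_eq_one, hV'.sum_eq_one, mul_one, mul_one] at h
  have h2 := Finset.sum_le_sum fun y (_ : y ∈ Finset.univ) => h1 y
  rw [Finset.sum_add_distrib, ← Finset.sum_div, Finset.sum_sub_distrib] at h2
  have h3 := hV.meanSqBias_add_le hV'
  have h4 : mutualInfo V = ∑ y, infoKernel (V 0 y) (V 1 y) := mutualInfo_eq_channelSum V
  have h5 : meanSqBias V = ∑ y, biasKernel (V 0 y) (V 1 y) := rfl
  rw [← h4, ← h5] at h2
  linarith

/-- The mean square bias is at least `δ / 2`. The Bhattacharyya parameter is at least `δ / 2` too,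
so one minus the bias is at least `δ ^ 2 / 4`. The constant is `1 / (2 * 16 * 8)`. -/
lemma IsBDMC.gain_lower_bound {Y : Type*} [Fintype Y] {V : ZMod 2 → Y → ℝ} (hV : IsBDMC V) {δ : ℝ}
    (hδ : 0 < δ) (h1 : δ ≤ mutualInfo V) (h2 : mutualInfo V ≤ 1 - δ) :
    δ ^ 5 / 256 ≤ meanSqBias V * (1 - meanSqBias V) ^ 2 / 8 := by
  have hm : δ / 2 ≤ meanSqBias V := by linarith [hV.mutualInfo_le]
  have hz : δ / 2 ≤ bhattacharyya V := by linarith [hV.one_sub_mutualInfo_le]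
  have hs : δ ^ 2 / 4 ≤ 1 - meanSqBias V := by nlinarith [hV.bhattacharyya_sq_le]
  have hs2 : (δ ^ 2 / 4) ^ 2 ≤ (1 - meanSqBias V) ^ 2 := by gcongr
  have := mul_le_mul hm hs2 (by positivity) hV.meanSqBias_nonneg
  nlinarith

/-! ### Averages over groups -/

/-- A surjective homomorphism carries the uniform law to the uniform law. By surjectivity every
translation of `B` lifts to `A` and leaves the average unchanged; averaging over all translations
makes it the average over `B`. -/
lemma Finset.expect_comp_of_surjective_add {A B : Type*} [AddGroup A] [AddGroup B] [Fintype A]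
    [Fintype B] (f : A → B) (hadd : ∀ a a', f (a + a') = f a + f a')
    (hf : Function.Surjective f) (h : B → ℝ) : 𝔼 a, h (f a) = 𝔼 b, h b := by
  have h1 : ∀ b, 𝔼 a, h (f a) = 𝔼 a, h (f a + b) := by
    intro b
    obtain ⟨a', rfl⟩ := hf b
    exact (Fintype.expect_equiv (Equiv.addRight a') _ _ fun a => by simp [hadd]).symm
  calc 𝔼 a, h (f a) = 𝔼 b : B, 𝔼 a, h (f a) := (Fintype.expect_const _).symm
    _ = 𝔼 b, 𝔼 a, h (f a + b) := Finset.expect_congr rfl fun b _ => h1 b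
    _ = 𝔼 a, 𝔼 b, h (f a + b) := Finset.expect_comm _ _ _
    _ = 𝔼 a : A, 𝔼 b, h b := Finset.expect_congr rfl fun a _ =>
        Fintype.expect_equiv (Equiv.addLeft (f a)) _ _ fun b => rfl
    _ = _ := Fintype.expect_const _

lemma Finset.expect_zmod_two (f : ZMod 2 → ℝ) : 𝔼 x, f x = (f 0 + f 1) / 2 := by
  rw [Fintype.expect_eq_sum_div_card, ZMod.card]
  congr 1
  exact Fin.sum_univ_two f

/-! ### Splicing input vectors -/

/-- The vector that agrees with `u` on the first `k` entries and with `w` afterwards. -/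
def splice {N : ℕ} (k : ℕ) (u w : Fin N → ZMod 2) : Fin N → ZMod 2 :=
  fun j => if (j : ℕ) < k then u j else w j

/-- The vector channel with the first `k` entries of its input fixed and the others uniform. -/
noncomputable def prefixAverage {Y : Type*} {N : ℕ} (W : ZMod 2 → Y → ℝ)
    (M : Matrix (Fin N) (Fin N) (ZMod 2)) (k : ℕ) (u : Fin N → ZMod 2) (y : Fin N → Y) : ℝ :=
  𝔼 w, vectorChannel W M (splice k u w) y

section

variable {N : ℕ}

lemma splice_congr {k : ℕ} {u u' : Fin N → ZMod 2} (h : ∀ j : Fin N, (j : ℕ) < k → u j = u' j)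
    (w : Fin N → ZMod 2) : splice k u w = splice k u' w := by
  funext j
  unfold splice
  split_ifs with hj
  · exact h j hj
  · rfl

lemma prefixAverage_congr {Y : Type*} {W : ZMod 2 → Y → ℝ} {M : Matrix (Fin N) (Fin N) (ZMod 2)}
    {k : ℕ} {u u' : Fin N → ZMod 2} (h : ∀ j : Fin N, (j : ℕ) < k → u j = u' j) (y : Fin N → Y) :
    prefixAverage W M k u y = prefixAverage W M k u' y := by
  unfold prefixAverage
  simp only [splice_congr h]

lemma card_filter_agree (k : ℕ) (hk : k ≤ N) (u : Fin N → ZMod 2) :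
    (Finset.univ.filter fun v : Fin N → ZMod 2 => ∀ j : Fin N, (j : ℕ) < k → v j = u j).card =
      2 ^ (N - k) := by
  classical
  have h : (Finset.univ.filter fun v : Fin N → ZMod 2 => ∀ j : Fin N, (j : ℕ) < k → v j = u j) =
      Fintype.piFinset fun j : Fin N => if (j : ℕ) < k then {u j} else Finset.univ := by
    ext v
    simp only [Finset.mem_filter, Finset.mem_univ, true_and, Fintype.mem_piFinset]
    refine forall_congr' fun j => ?_
    split_ifs with hj <;> simp [hj]
  rw [h, Fintype.card_piFinset]
  have h2 : ∀ j : Fin N, (if (j : ℕ) < k then {u j} else Finset.univ : Finset (ZMod 2)).card =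
      if ¬ (j : ℕ) < k then 2 else 1 := by
    intro j
    split_ifs <;> simp_all [ZMod.card]
  simp only [h2]
  rw [Finset.prod_ite, Finset.prod_const_one, mul_one, Finset.prod_const]
  congr 1
  have h3 := Finset.card_filter_add_card_filter_not (s := (Finset.univ : Finset (Fin N)))
    (fun j : Fin N => (j : ℕ) < k)
  rw [Fin.card_filter_val_lt, Finset.card_univ, Fintype.card_fin] at h3
  omega

lemma expect_splice (k : ℕ) (F : (Fin N → ZMod 2) → ℝ) :
    𝔼 u, 𝔼 w, F (splice k u w) = 𝔼 v, F v := by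
  rw [← Finset.expect_product' Finset.univ Finset.univ fun u w => F (splice k u w),
    Finset.univ_product_univ]
  refine Finset.expect_comp_of_surjective_add
    (fun q : (Fin N → ZMod 2) × (Fin N → ZMod 2) => splice k q.1 q.2) ?_ ?_ F
  · intro a b
    funext j
    simp only [splice, Prod.fst_add, Prod.snd_add, Pi.add_apply]
    split_ifs <;> rfl
  · intro v
    refine ⟨(v, v), ?_⟩
    funext j
    simp [splice]

lemma sum_filter_agree (k : ℕ) (hk : k ≤ N) (u : Fin N → ZMod 2) (g : (Fin N → ZMod 2) → ℝ) :
    ∑ v : Fin N → ZMod 2 with ∀ j : Fin N, (j : ℕ) < k → v j = u j, g v =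
      2 ^ (N - k) * 𝔼 w, g (splice k u w) := by
  classical
  -- The indicator depends only on the prefix and the remaining factor only on the suffix, so the
  -- double average factors.
  have h1 := expect_splice k fun v : Fin N → ZMod 2 =>
    if ∀ j : Fin N, (j : ℕ) < k → v j = u j then g v else 0
  have h2 : ∀ u' w : Fin N → ZMod 2,
      (if ∀ j : Fin N, (j : ℕ) < k → splice k u' w j = u j then g (splice k u' w) else 0) =
      (if ∀ j : Fin N, (j : ℕ) < k → u' j = u j then 1 else 0) * g (splice k u w) := by
    intro u' w
    have h3 : (∀ j : Fin N, (j : ℕ) < k → splice k u' w j = u j) ↔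
        ∀ j : Fin N, (j : ℕ) < k → u' j = u j :=
      forall₂_congr fun j hj => by simp [splice, hj]
    by_cases h : ∀ j : Fin N, (j : ℕ) < k → u' j = u j
    · rw [if_pos (h3.2 h), if_pos h, one_mul, splice_congr h]
    · rw [if_neg (mt h3.1 h), if_neg h, zero_mul]
  simp only [h2] at h1
  simp only [← Finset.mul_expect] at h1
  rw [← Finset.expect_mul] at h1
  generalize 𝔼 w, g (splice k u w) = E at h1 ⊢
  have hc : (Fintype.card (Fin N → ZMod 2) : ℝ) ≠ 0 := by simp
  rw [Fintype.expect_eq_sum_div_card, Fintype.expect_eq_sum_div_card, div_mul_eq_mul_div,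
    div_left_inj' hc] at h1
  rw [Finset.sum_boole, card_filter_agree k hk] at h1
  rw [Finset.sum_filter, ← h1]
  push_cast
  rfl

end

/-! ### The synthesized channels as averages -/

section

variable {Y : Type*} {N : ℕ} {W : ZMod 2 → Y → ℝ} {M : Matrix (Fin N) (Fin N) (ZMod 2)}

/-- Extension by zero of the first entries of an input vector. -/
def extendPast (i : Fin N) (p : {j : Fin N // j < i} → ZMod 2) : Fin N → ZMod 2 :=
  fun j => if h : j < i then p ⟨j, h⟩ else 0

/-- Of the factor `2 ^ (-(N - 1))`, the part `2 ^ (-(N - 1 - i))` averages over the later bits; what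
is left is the probability of the past. -/
lemma synthChannel_eq (i : Fin N) (x : ZMod 2)
    (y : Fin N → Y) (p : {j : Fin N // j < i} → ZMod 2) :
    synthChannel W M i x (y, p) = (1 / 2 ^ (i : ℕ)) *
      prefixAverage W M (i + 1) (Function.update (extendPast i p) i x) y := by
  classical
  have hf : (Finset.univ.filter fun u : Fin N → ZMod 2 =>
      (∀ j : {j : Fin N // j < i}, u j = p j) ∧ u i = x) =
      Finset.univ.filter fun v : Fin N → ZMod 2 => ∀ j : Fin N, (j : ℕ) < i + 1 →
        v j = Function.update (extendPast i p) i x j := by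
    ext v
    simp only [Finset.mem_filter, Finset.mem_univ, true_and]
    constructor
    · rintro ⟨h1, h2⟩ j hj
      rcases eq_or_ne j i with rfl | hne
      · simpa using h2
      · have hlt : j < i := by
          rw [Fin.lt_def]
          have := Fin.val_ne_of_ne hne
          omega
        rw [Function.update_of_ne hne, extendPast, dif_pos hlt]
        exact h1 ⟨j, hlt⟩
    · intro h
      refine ⟨fun j => ?_, ?_⟩
      · have := h j (Nat.lt_succ_of_lt j.2)
        rw [Function.update_of_ne j.2.ne, extendPast, dif_pos j.2] at this
        exact this
      · simpa using h i (Nat.lt_succ_self _)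
  have hi := i.2
  simp only [synthChannel]
  rw [hf, sum_filter_agree _ hi, ← mul_assoc, prefixAverage]
  congr 1
  rw [show N - 1 = (N - (i + 1)) + i by omega, pow_add]
  field_simp

lemma zeroPastChannel_eq (i : Fin N) (x : ZMod 2) (y : Fin N → Y) :
    zeroPastChannel W M i x y = prefixAverage W M (i + 1) (Function.update 0 i x) y := by
  classical
  have hf : (Finset.univ.filter fun u : Fin N → ZMod 2 => (∀ j, j < i → u j = 0) ∧ u i = x) =
      Finset.univ.filter fun v : Fin N → ZMod 2 => ∀ j : Fin N, (j : ℕ) < i + 1 →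
        v j = Function.update (0 : Fin N → ZMod 2) i x j := by
    ext v
    simp only [Finset.mem_filter, Finset.mem_univ, true_and]
    constructor
    · rintro ⟨h1, h2⟩ j hj
      rcases eq_or_ne j i with rfl | hne
      · simpa using h2
      · have hlt : j < i := by
          rw [Fin.lt_def]
          have := Fin.val_ne_of_ne hne
          omega
        rw [Function.update_of_ne hne]
        exact h1 j hlt
    · intro h
      refine ⟨fun j hj => ?_, ?_⟩
      · have := h j (Nat.lt_succ_of_lt hj)
        rwa [Function.update_of_ne hj.ne] at this
      · simpa using h i (Nat.lt_succ_self _)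
  have hi := i.2
  simp only [zeroPastChannel]
  rw [hf, sum_filter_agree _ hi, ← mul_assoc, prefixAverage,
    show N - 1 - (i : ℕ) = N - (i + 1) by omega]
  field_simp

lemma expect_restrict {ι : Type*} [Fintype ι] [DecidableEq ι] (p : ι → Prop) [DecidablePred p]
    (h : ({j // p j} → ZMod 2) → ℝ) :
    𝔼 u : ι → ZMod 2, h (fun j => u j) = 𝔼 r, h r := by
  refine Finset.expect_comp_of_surjective_add
    (fun (u : ι → ZMod 2) (j : {j // p j}) => u j) (fun _ _ => rfl) ?_ h
  intro r
  refine ⟨fun j => if hj : p j then r ⟨j, hj⟩ else 0, ?_⟩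
  funext j
  simp [j.2]

lemma card_past (i : Fin N) : Fintype.card ({j : Fin N // j < i} → ZMod 2) = 2 ^ (i : ℕ) := by
  rw [Fintype.card_fun, ZMod.card, Fintype.card_subtype]
  have h := Fin.card_filter_val_lt (n := N) (m := (i : ℕ))
  rw [min_eq_right i.2.le] at h
  simp only [Fin.lt_def, h]

lemma vectorChannel_nonneg (hW : ∀ x y, 0 ≤ W x y) (u : Fin N → ZMod 2) (y : Fin N → Y) :
    0 ≤ vectorChannel W M u y :=
  Finset.prod_nonneg fun _ _ => hW _ _

lemma prefixAverage_nonneg (hW : ∀ x y, 0 ≤ W x y) (k : ℕ) (u : Fin N → ZMod 2) (y : Fin N → Y) :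
    0 ≤ prefixAverage W M k u y :=
  Finset.expect_nonneg fun _ _ => vectorChannel_nonneg hW _ _

variable [Fintype Y]

lemma sum_vectorChannel (hW : IsBDMC W) (u : Fin N → ZMod 2) :
    ∑ y, vectorChannel W M u y = 1 := by
  classical
  simp only [vectorChannel]
  rw [← Fintype.prod_sum fun j a => W ((u ᵥ* M) j) a]
  exact Finset.prod_eq_one fun j _ => hW.sum_eq_one _

lemma sum_prefixAverage (hW : IsBDMC W) (k : ℕ) (u : Fin N → ZMod 2) :
    ∑ y, prefixAverage W M k u y = 1 := by
  unfold prefixAverage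
  rw [← Finset.expect_sum_comm]
  exact (Finset.expect_congr rfl fun w _ => sum_vectorChannel hW _).trans (Fintype.expect_const _)

lemma IsBDMC.synthChannel (hW : IsBDMC W) (i : Fin N) : IsBDMC (synthChannel W M i) where
  nonneg x o := by
    rw [synthChannel_eq i x o.1 o.2]
    exact mul_nonneg (by positivity) (prefixAverage_nonneg hW.nonneg _ _ _)
  sum_eq_one x := by
    rw [Fintype.sum_prod_type_right]
    simp only [synthChannel_eq, ← Finset.mul_sum, sum_prefixAverage hW, mul_one]
    rw [Finset.sum_const, Finset.card_univ, card_past, nsmul_eq_mul]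
    push_cast
    field_simp

/-- Homogeneity pulls out the factor `2 ^ (-i)`, which turns the sum over pasts into an average. The
average runs over full vectors `u`, of which only the past matters; this spares dependent index
types later. -/
lemma channelSum_synthChannel {φ : ℝ → ℝ → ℝ} (hφ : IsKernel φ) (hW : ∀ x y, 0 ≤ W x y)
    (i : Fin N) :
    channelSum φ (synthChannel W M i) = 𝔼 u, ∑ y,
      φ (prefixAverage W M (i + 1) (Function.update u i 0) y)
        (prefixAverage W M (i + 1) (Function.update u i 1) y) := by
  unfold channelSum
  rw [Fintype.sum_prod_type_right]
  simp only [synthChannel_eq]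
  have h1 : ∀ (p : {j : Fin N // j < i} → ZMod 2) (y : Fin N → Y),
      φ (1 / 2 ^ (i : ℕ) * prefixAverage W M (i + 1) (Function.update (extendPast i p) i 0) y)
        (1 / 2 ^ (i : ℕ) * prefixAverage W M (i + 1) (Function.update (extendPast i p) i 1) y) =
      1 / 2 ^ (i : ℕ) *
        φ (prefixAverage W M (i + 1) (Function.update (extendPast i p) i 0) y)
          (prefixAverage W M (i + 1) (Function.update (extendPast i p) i 1) y) := fun p y =>
    hφ.homog _ _ _ (by positivity) (prefixAverage_nonneg hW _ _ _) (prefixAverage_nonneg hW _ _ _)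
  simp only [h1, ← Finset.mul_sum]
  have h2 := expect_restrict (fun j : Fin N => j < i) fun p => ∑ y,
    φ (prefixAverage W M (i + 1) (Function.update (extendPast i p) i 0) y)
      (prefixAverage W M (i + 1) (Function.update (extendPast i p) i 1) y)
  rw [Fintype.expect_eq_sum_div_card (ι := {j : Fin N // j < i} → ZMod 2), card_past] at h2
  rw [one_div_mul_eq_div]
  push_cast at h2
  rw [← h2]
  have h3 : ∀ (u : Fin N → ZMod 2) (x : ZMod 2) (j : Fin N), (j : ℕ) < i + 1 →
      Function.update (extendPast i fun j => u j) i x j = Function.update u i x j := by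
    intro u x j hj
    rcases eq_or_ne j i with rfl | hne
    · simp
    · have hlt : j < i := by
        rw [Fin.lt_def]
        have := Fin.val_ne_of_ne hne
        omega
      rw [Function.update_of_ne hne, Function.update_of_ne hne, extendPast, dif_pos hlt]
  refine Finset.expect_congr rfl fun u _ => Finset.sum_congr rfl fun y _ => ?_
  rw [prefixAverage_congr (h3 u 0), prefixAverage_congr (h3 u 1)]

end

/-! ### Digits and the recursive structure of the polar transform -/

section Digits

variable {ℓ : ℕ}

/-- Appending a least significant digit. -/
def appendLow (ℓ n : ℕ) : Fin (ℓ ^ n) × Fin ℓ ≃ Fin (ℓ ^ (n + 1)) :=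
  finProdFinEquiv.trans (finCongr (pow_succ ℓ n).symm)

/-- Prepending a most significant digit. -/
def prependHigh (ℓ n : ℕ) : Fin ℓ × Fin (ℓ ^ n) ≃ Fin (ℓ ^ (n + 1)) :=
  finProdFinEquiv.trans (finCongr (pow_succ' ℓ n).symm)

lemma appendLow_val (n : ℕ) (a : Fin (ℓ ^ n)) (r : Fin ℓ) :
    (appendLow ℓ n (a, r) : ℕ) = r + ℓ * a := rfl

lemma prependHigh_val (n : ℕ) (c : Fin ℓ) (b : Fin (ℓ ^ n)) :
    (prependHigh ℓ n (c, b) : ℕ) = b + ℓ ^ n * c := rfl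

lemma digit_val (n : ℕ) (a : Fin (ℓ ^ n)) (k : Fin n) :
    (finFunctionFinEquiv.symm a k : ℕ) = a / ℓ ^ (k : ℕ) % ℓ := by
  simp [finFunctionFinEquiv]

lemma digit_appendLow_zero (n : ℕ) (a : Fin (ℓ ^ n)) (r : Fin ℓ) :
    finFunctionFinEquiv.symm (appendLow ℓ n (a, r)) 0 = r := by
  apply Fin.ext
  rw [digit_val, appendLow_val]
  simp [Nat.mod_eq_of_lt r.2]

lemma digit_appendLow_succ (n : ℕ) (a : Fin (ℓ ^ n)) (r : Fin ℓ) (k : Fin n) :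
    finFunctionFinEquiv.symm (appendLow ℓ n (a, r)) k.succ = finFunctionFinEquiv.symm a k := by
  apply Fin.ext
  have hl : 0 < ℓ := r.pos
  rw [digit_val, digit_val, appendLow_val, Fin.val_succ, pow_succ', ← Nat.div_div_eq_div_mul,
    Nat.add_mul_div_left _ _ hl, Nat.div_eq_of_lt r.2, zero_add]

lemma digit_prependHigh_last (n : ℕ) (c : Fin ℓ) (b : Fin (ℓ ^ n)) :
    finFunctionFinEquiv.symm (prependHigh ℓ n (c, b)) (Fin.last n) = c := by
  apply Fin.ext
  have hl : 0 < ℓ := c.pos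
  rw [digit_val, prependHigh_val, Fin.val_last, Nat.add_mul_div_left _ _ (by positivity),
    Nat.div_eq_of_lt b.2, zero_add, Nat.mod_eq_of_lt c.2]

lemma digit_prependHigh_castSucc (n : ℕ) (c : Fin ℓ) (b : Fin (ℓ ^ n)) (k : Fin n) :
    finFunctionFinEquiv.symm (prependHigh ℓ n (c, b)) k.castSucc =
      finFunctionFinEquiv.symm b k := by
  apply Fin.ext
  have hl : 0 < ℓ := c.pos
  rw [digit_val, digit_val, prependHigh_val, Fin.val_castSucc]
  generalize (b : ℕ) = m
  have h : ℓ ^ n = ℓ ^ (k : ℕ) * (ℓ * ℓ ^ (n - 1 - k)) := by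
    rw [← pow_succ', ← pow_add]
    congr 1
    have := k.2
    omega
  rw [h, mul_assoc, Nat.add_mul_div_left _ _ (by positivity), mul_assoc, Nat.add_mul_mod_self_left]

/-- Lexicographic order: the past of `(i, r)` is all blocks before `i` and the entries before `r` in
block `i`, as the recursion needs. -/
lemma appendLow_lt_iff (n : ℕ) (a a' : Fin (ℓ ^ n)) (r r' : Fin ℓ) :
    appendLow ℓ n (a, r) < appendLow ℓ n (a', r') ↔ a < a' ∨ a = a' ∧ r < r' := by
  rw [Fin.lt_def, appendLow_val, appendLow_val, Fin.lt_def, Fin.lt_def, Fin.ext_iff]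
  have h1 := r.2
  have h2 := r'.2
  constructor
  · intro h
    rcases lt_trichotomy (a : ℕ) a' with h3 | h3 | h3
    · exact Or.inl h3
    · rw [h3] at h
      exact Or.inr ⟨h3, by omega⟩
    · have := Nat.mul_le_mul_left ℓ (Nat.succ_le_of_lt h3)
      rw [Nat.mul_succ] at this
      omega
  · rintro (h | ⟨h, h'⟩)
    · have := Nat.mul_le_mul_left ℓ (Nat.succ_le_of_lt h)
      rw [Nat.mul_succ] at this
      omega
    · rw [h]
      omega

lemma polarTransform_apply (G : Matrix (Fin ℓ) (Fin ℓ) (ZMod 2)) (n : ℕ) (a b : Fin (ℓ ^ n)) :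
    polarTransform G n a b = ∏ k : Fin n,
      G (finFunctionFinEquiv.symm a k.rev) (finFunctionFinEquiv.symm b k) := by
  unfold polarTransform Equiv.Perm.permMatrix
  rw [PEquiv.toMatrix_toPEquiv_mul, Matrix.submatrix_apply]
  unfold kroneckerPow digitReversal
  simp [Equiv.arrowCongr]

/-- Digit reversal pairs the lowest digit of the row index with the highest digit of the column
index. Thus consecutive inputs form a block for `G`, while the outputs split into ℓ contiguous
copies of level `n`. -/
lemma polarTransform_succ (G : Matrix (Fin ℓ) (Fin ℓ) (ZMod 2)) (n : ℕ) (a b : Fin (ℓ ^ n))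
    (r c : Fin ℓ) :
    polarTransform G (n + 1) (appendLow ℓ n (a, r)) (prependHigh ℓ n (c, b)) =
      polarTransform G n a b * G r c := by
  rw [polarTransform_apply, polarTransform_apply, Fin.prod_univ_castSucc]
  congr 1
  · refine Finset.prod_congr rfl fun k _ => ?_
    rw [Fin.rev_castSucc, digit_appendLow_succ, digit_prependHigh_castSucc]
  · rw [Fin.rev_last, digit_appendLow_zero, digit_prependHigh_last]

end Digits

/-! ### One step of the recursion -/

section Recursion

variable {Y : Type*} {ℓ n : ℕ} {W : ZMod 2 → Y → ℝ} {G : Matrix (Fin ℓ) (Fin ℓ) (ZMod 2)}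

lemma vectorChannel_polarTransform_succ (v : Fin (ℓ ^ (n + 1)) → ZMod 2)
    (y : Fin (ℓ ^ (n + 1)) → Y) :
    vectorChannel W (polarTransform G (n + 1)) v y =
      ∏ c, vectorChannel W (polarTransform G n)
        (fun a => ((fun r => v (appendLow ℓ n (a, r))) ᵥ* G) c)
        (fun b => y (prependHigh ℓ n (c, b))) := by
  unfold vectorChannel
  rw [← (prependHigh ℓ n).prod_comp, Fintype.prod_prod_type]
  refine Finset.prod_congr rfl fun c _ => Finset.prod_congr rfl fun b _ => ?_
  congr 1
  simp only [Matrix.vecMul, dotProduct]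
  rw [← (appendLow ℓ n).sum_comp, Fintype.sum_prod_type]
  refine Finset.sum_congr rfl fun a _ => ?_
  rw [Finset.sum_mul]
  refine Finset.sum_congr rfl fun r _ => ?_
  rw [polarTransform_succ]
  ring

lemma Finset.prod_expect_eq_expect_prod {ι κ : Type*} [Fintype ι] [DecidableEq ι] [Fintype κ]
    (f : ι → κ → ℝ) : ∏ c, 𝔼 w, f c w = 𝔼 w : ι → κ, ∏ c, f c (w c) := by
  simp only [Fintype.expect_eq_sum_div_card]
  rw [Finset.prod_div_distrib, Fintype.prod_sum]
  simp

/-- The length-`ℓ ^ (n + 1)` vector whose rows of length `ℓ` are `s` at position `i` and otherwise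
mapped by `G` to the columns of `u`. -/
noncomputable def assembleRows (G : Matrix (Fin ℓ) (Fin ℓ) (ZMod 2)) (i : Fin (ℓ ^ n))
    (s : Fin ℓ → ZMod 2) (u : Fin ℓ → Fin (ℓ ^ n) → ZMod 2) : Fin (ℓ ^ (n + 1)) → ZMod 2 :=
  fun a => if ((appendLow ℓ n).symm a).1 = i then s ((appendLow ℓ n).symm a).2
    else ((fun c => u c ((appendLow ℓ n).symm a).1) ᵥ* G⁻¹) ((appendLow ℓ n).symm a).2

lemma assembleRows_appendLow (i : Fin (ℓ ^ n)) (s : Fin ℓ → ZMod 2)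
    (u : Fin ℓ → Fin (ℓ ^ n) → ZMod 2) (a : Fin (ℓ ^ n)) (r : Fin ℓ) :
    assembleRows G i s u (appendLow ℓ n (a, r)) =
      if a = i then s r else ((fun c => u c a) ᵥ* G⁻¹) r := by
  simp [assembleRows]

/-- The map is additive, and surjective because `G` is invertible; the entries of `u` at position
`i` are simply ignored. -/
lemma expect_assembleRows (hG : IsUnit G) (i : Fin (ℓ ^ n))
    (h : (Fin (ℓ ^ (n + 1)) → ZMod 2) → ℝ) :
    𝔼 s, 𝔼 u, h (assembleRows G i s u) = 𝔼 v, h v := by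
  rw [← Finset.expect_product' Finset.univ Finset.univ fun s u => h (assembleRows G i s u),
    Finset.univ_product_univ]
  refine Finset.expect_comp_of_surjective_add
    (fun q : (Fin ℓ → ZMod 2) × (Fin ℓ → Fin (ℓ ^ n) → ZMod 2) => assembleRows G i q.1 q.2) ?_ ?_ h
  · rintro ⟨s, u⟩ ⟨s', u'⟩
    funext a
    simp only [assembleRows, Pi.add_apply, Prod.mk_add_mk]
    split_ifs
    · rfl
    · rw [← Pi.add_apply, ← Matrix.add_vecMul]
      rfl
  · intro v
    refine ⟨(fun r => v (appendLow ℓ n (i, r)),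
      fun c a => ((fun r => v (appendLow ℓ n (a, r))) ᵥ* G) c), ?_⟩
    funext b
    obtain ⟨⟨a, r⟩, rfl⟩ := (appendLow ℓ n).surjective b
    refine (assembleRows_appendLow i _ _ a r).trans ?_
    split_ifs with ha
    · rw [ha]
    · have hG' : IsUnit G.det := (Matrix.isUnit_iff_isUnit_det G).1 hG
      change (((fun r => v (appendLow ℓ n (a, r))) ᵥ* G) ᵥ* G⁻¹) r = _
      rw [Matrix.vecMul_vecMul, Matrix.mul_nonsing_inv _ hG', Matrix.vecMul_one]

/-- Multiplication by `G` undoes `G⁻¹` on all rows but `i`: rows before `i` supply the past of each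
copy, rows after `i` its future, and row `i`, spliced at `r`, supplies the current bits of the ℓ
copies. -/
lemma vectorChannel_splice_assembleRows (hG : IsUnit G) (i : Fin (ℓ ^ n)) (r : Fin ℓ) (x : ZMod 2)
    (s t : Fin ℓ → ZMod 2) (u w : Fin ℓ → Fin (ℓ ^ n) → ZMod 2) (y : Fin (ℓ ^ (n + 1)) → Y) :
    vectorChannel W (polarTransform G (n + 1)) (splice (appendLow ℓ n (i, r) + 1)
        (Function.update (assembleRows G i s u) (appendLow ℓ n (i, r)) x)
        (assembleRows G i t w)) y =
      ∏ c, vectorChannel W (polarTransform G n) (splice (i + 1)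
        (Function.update (u c) i ((splice (r + 1) (Function.update s r x) t ᵥ* G) c)) (w c))
        (fun b => y (prependHigh ℓ n (c, b))) := by
  have hG' : IsUnit G.det := (Matrix.isUnit_iff_isUnit_det G).1 hG
  have hinv : ∀ z : Fin ℓ → ZMod 2, (z ᵥ* G⁻¹) ᵥ* G = z := fun z => by
    rw [Matrix.vecMul_vecMul, Matrix.nonsing_inv_mul _ hG', Matrix.vecMul_one]
  rw [vectorChannel_polarTransform_succ]
  refine Finset.prod_congr rfl fun c _ => ?_
  congr 1
  funext a
  have hcmp : ∀ r', ((appendLow ℓ n (a, r') : ℕ) < appendLow ℓ n (i, r) + 1 ↔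
      a < i ∨ a = i ∧ (r' : ℕ) < r + 1) := by
    intro r'
    rw [Nat.lt_succ_iff, Nat.lt_succ_iff, ← Fin.le_def, ← Fin.le_def, ← not_lt, appendLow_lt_iff,
      ← not_lt]
    constructor
    · intro h
      push Not at h
      rcases lt_trichotomy a i with h1 | h1 | h1
      · exact Or.inl h1
      · exact Or.inr ⟨h1, not_lt.2 (h.2 h1.symm)⟩
      · exact absurd h1 (not_lt.2 h.1)
    · rintro (h | ⟨h, h'⟩) (h2 | ⟨h2, h3⟩)
      · exact lt_asymm h h2
      · exact h.ne h2.symm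
      · exact h2.ne h.symm
      · exact h' h3
  rcases lt_trichotomy a i with h | h | h
  · have e : (fun r' => splice (appendLow ℓ n (i, r) + 1)
        (Function.update (assembleRows G i s u) (appendLow ℓ n (i, r)) x)
        (assembleRows G i t w) (appendLow ℓ n (a, r'))) = (fun c => u c a) ᵥ* G⁻¹ := by
      funext r'
      unfold splice
      rw [if_pos ((hcmp r').2 (Or.inl h)), Function.update_of_ne, assembleRows_appendLow,
        if_neg h.ne]
      intro h'
      exact h.ne (Prod.ext_iff.1 ((appendLow ℓ n).injective h')).1
    rw [e, hinv]
    unfold splice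
    rw [if_pos (Nat.lt_succ_of_lt h), Function.update_of_ne h.ne]
  · subst h
    have e : (fun r' => splice (appendLow ℓ n (a, r) + 1)
        (Function.update (assembleRows G a s u) (appendLow ℓ n (a, r)) x)
        (assembleRows G a t w) (appendLow ℓ n (a, r'))) =
        splice (r + 1) (Function.update s r x) t := by
      funext r'
      unfold splice
      have : ((appendLow ℓ n (a, r') : ℕ) < appendLow ℓ n (a, r) + 1) ↔ (r' : ℕ) < r + 1 := by
        rw [hcmp]; simp
      simp only [this]
      split_ifs
      · rcases eq_or_ne r' r with rfl | hne
        · simp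
        · rw [Function.update_of_ne hne, Function.update_of_ne, assembleRows_appendLow, if_pos rfl]
          intro h'
          exact hne (Prod.ext_iff.1 ((appendLow ℓ n).injective h')).2
      · rw [assembleRows_appendLow, if_pos rfl]
    rw [e]
    simp [splice]
  · have e : (fun r' => splice (appendLow ℓ n (i, r) + 1)
        (Function.update (assembleRows G i s u) (appendLow ℓ n (i, r)) x)
        (assembleRows G i t w) (appendLow ℓ n (a, r'))) = (fun c => w c a) ᵥ* G⁻¹ := by
      funext r'
      unfold splice
      have h1 : ¬ ((appendLow ℓ n (a, r') : ℕ) < appendLow ℓ n (i, r) + 1) := by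
        rw [hcmp]
        rintro (h' | ⟨h', -⟩)
        · exact lt_asymm h h'
        · exact h.ne h'.symm
      rw [if_neg h1, assembleRows_appendLow, if_neg h.ne']
    rw [e, hinv]
    unfold splice
    rw [if_neg]
    have := Fin.lt_def.1 h
    omega

lemma prefixAverage_polarTransform_succ (hG : IsUnit G) (i : Fin (ℓ ^ n)) (r : Fin ℓ) (x : ZMod 2)
    (s : Fin ℓ → ZMod 2) (u : Fin ℓ → Fin (ℓ ^ n) → ZMod 2) (y : Fin (ℓ ^ (n + 1)) → Y) :
    prefixAverage W (polarTransform G (n + 1)) (appendLow ℓ n (i, r) + 1)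
        (Function.update (assembleRows G i s u) (appendLow ℓ n (i, r)) x) y =
      𝔼 t, ∏ c, prefixAverage W (polarTransform G n) (i + 1)
        (Function.update (u c) i ((splice (r + 1) (Function.update s r x) t ᵥ* G) c))
        (fun b => y (prependHigh ℓ n (c, b))) := by
  unfold prefixAverage
  rw [← expect_assembleRows hG i]
  refine Finset.expect_congr rfl fun t _ => ?_
  rw [Finset.prod_expect_eq_expect_prod]
  refine Finset.expect_congr rfl fun w _ => ?_
  exact vectorChannel_splice_assembleRows hG i r x s t u w y

lemma prefixAverage_synthChannel {N : ℕ} {M : Matrix (Fin N) (Fin N) (ZMod 2)} (i : Fin N)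
    (k : ℕ) (s : Fin ℓ → ZMod 2) (y : Fin ℓ → Fin N → Y)
    (p : Fin ℓ → {j : Fin N // j < i} → ZMod 2) :
    prefixAverage (synthChannel W M i) G k s (fun c => (y c, p c)) =
      (1 / 2 ^ (i : ℕ)) ^ ℓ * 𝔼 t, ∏ c, prefixAverage W M (i + 1)
        (Function.update (extendPast i (p c)) i ((splice k s t ᵥ* G) c)) (y c) := by
  rw [Finset.mul_expect, prefixAverage]
  refine Finset.expect_congr rfl fun t _ => ?_
  unfold vectorChannel
  simp only [synthChannel_eq]
  rw [Finset.prod_mul_distrib, Finset.prod_const, Finset.card_univ, Fintype.card_fin]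

variable [Fintype Y]

/-- The channels at level `n + 1` arise from those at level `n` by one application of `G`. -/
lemma channelSum_polarTransform_succ {φ : ℝ → ℝ → ℝ} (hφ : IsKernel φ) (hW : IsBDMC W)
    (hG : IsUnit G) (i : Fin (ℓ ^ n)) (r : Fin ℓ) :
    channelSum φ (synthChannel W (polarTransform G (n + 1)) (appendLow ℓ n (i, r))) =
      channelSum φ (synthChannel (synthChannel W (polarTransform G n) i) G r) := by
  rw [channelSum_synthChannel hφ hW.nonneg, channelSum_synthChannel hφ (hW.synthChannel i).nonneg,
    ← expect_assembleRows hG i]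
  refine Finset.expect_congr rfl fun s _ => ?_
  simp only [prefixAverage_polarTransform_succ hG]
  set B : ZMod 2 → (Fin ℓ → Fin (ℓ ^ n) → ZMod 2) → (Fin ℓ → Fin (ℓ ^ n) → Y) → ℝ :=
    fun x u y => 𝔼 t, ∏ c, prefixAverage W (polarTransform G n) (i + 1)
        (Function.update (u c) i ((splice (r + 1) (Function.update s r x) t ᵥ* G) c)) (y c) with hB
  have hB0 : ∀ x u y, 0 ≤ B x u y := fun x u y => Finset.expect_nonneg fun t _ =>
    Finset.prod_nonneg fun c _ => prefixAverage_nonneg hW.nonneg _ _ _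
  have hL : ∀ u : Fin ℓ → Fin (ℓ ^ n) → ZMod 2, ∑ y : Fin (ℓ ^ (n + 1)) → Y,
      φ (B 0 u fun c b => y (prependHigh ℓ n (c, b))) (B 1 u fun c b => y (prependHigh ℓ n (c, b)))
      = ∑ y, φ (B 0 u y) (B 1 u y) := fun u =>
    Fintype.sum_equiv (((prependHigh ℓ n).symm.arrowCongr (Equiv.refl Y)).trans
      (Equiv.curry _ _ _)) _ _ fun y => rfl
  -- On this side the pasts of the ℓ copies are outputs. Homogeneity extracts their probability `(2
  -- ^ (-i)) ^ ℓ`, and the sum over them becomes an average.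
  have hR : ∑ o : Fin ℓ → (Fin (ℓ ^ n) → Y) × ({j : Fin (ℓ ^ n) // j < i} → ZMod 2),
      φ (prefixAverage (synthChannel W (polarTransform G n) i) G (r + 1) (Function.update s r 0) o)
        (prefixAverage (synthChannel W (polarTransform G n) i) G (r + 1) (Function.update s r 1) o)
      = 𝔼 p : Fin ℓ → {j : Fin (ℓ ^ n) // j < i} → ZMod 2,
        ∑ y, φ (B 0 (fun c => extendPast i (p c)) y) (B 1 (fun c => extendPast i (p c)) y) := by
    rw [← (Equiv.arrowProdEquivProdArrow (Fin ℓ) (fun _ => Fin (ℓ ^ n) → Y)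
      (fun _ => {j : Fin (ℓ ^ n) // j < i} → ZMod 2)).symm.sum_comp, Fintype.sum_prod_type_right,
      Fintype.expect_eq_sum_div_card, Finset.sum_div]
    refine Finset.sum_congr rfl fun p _ => ?_
    rw [Finset.sum_div]
    refine Finset.sum_congr rfl fun y _ => ?_
    have e : ∀ x, prefixAverage (synthChannel W (polarTransform G n) i) G (r + 1)
        (Function.update s r x) ((Equiv.arrowProdEquivProdArrow (Fin ℓ)
          (fun _ => Fin (ℓ ^ n) → Y)
          (fun _ => {j : Fin (ℓ ^ n) // j < i} → ZMod 2)).symm (y, p)) =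
        (1 / 2 ^ (i : ℕ)) ^ ℓ * B x (fun c => extendPast i (p c)) y := fun x =>
      prefixAverage_synthChannel i (r + 1) (Function.update s r x) y p
    rw [e, e, hφ.homog _ _ _ (by positivity) (hB0 _ _ _) (hB0 _ _ _), Fintype.card_fun, card_past,
      Fintype.card_fin]
    push_cast
    rw [one_div_pow, one_div_mul_eq_div]
  rw [hR]
  refine (Finset.expect_congr rfl fun u _ => hL u).trans ?_
  rw [← Finset.expect_comp_of_surjective_add
    (fun (u : Fin ℓ → Fin (ℓ ^ n) → ZMod 2) c (j : {j : Fin (ℓ ^ n) // j < i}) => u c j)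
    (fun _ _ => rfl) (fun p => ⟨fun c => extendPast i (p c), by
      funext c j; simp [extendPast, j.2]⟩)]
  refine Finset.expect_congr rfl fun u _ => Finset.sum_congr rfl fun y _ => ?_
  -- Only entries up to `i` enter, and entry `i` itself is overwritten.
  have e : ∀ x, B x u y = B x (fun c => extendPast i fun j => u c j) y := by
    intro x
    refine Finset.expect_congr rfl fun t _ => Finset.prod_congr rfl fun c _ =>
      prefixAverage_congr (fun j hj => ?_) _
    rcases eq_or_ne j i with rfl | hne
    · simp
    · have hlt : j < i := by
        rw [Fin.lt_def]
        have := Fin.val_ne_of_ne hne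
        omega
      rw [Function.update_of_ne hne, Function.update_of_ne hne]
      simp [extendPast, hlt]
  rw [e 0, e 1]

/-- With a transform of length one, the channel is unchanged. -/
lemma channelSum_polarTransform_zero {φ : ℝ → ℝ → ℝ} (hφ : IsKernel φ) (hW : IsBDMC W)
    (i : Fin (ℓ ^ 0)) :
    channelSum φ (synthChannel W (polarTransform G 0) i) = channelSum φ W := by
  have hone : ∀ j : Fin (ℓ ^ 0), j = i := fun j =>
    Fin.ext ((Nat.lt_one_iff.1 j.2).trans (Nat.lt_one_iff.1 i.2).symm)
  rw [channelSum_synthChannel hφ hW.nonneg]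
  have key : ∀ (u : Fin (ℓ ^ 0) → ZMod 2) (x : ZMod 2) (y : Fin (ℓ ^ 0) → Y),
      prefixAverage W (polarTransform G 0) (i + 1) (Function.update u i x) y = W x (y i) := by
    intro u x y
    have e : ∀ w, vectorChannel W (polarTransform G 0)
        (splice (i + 1) (Function.update u i x) w) y = W x (y i) := by
      intro w
      unfold vectorChannel
      rw [Fintype.prod_eq_single i fun j hj => absurd (hone j) hj]
      congr 1
      simp only [Matrix.vecMul, dotProduct]
      rw [Fintype.sum_eq_single i fun j hj => absurd (hone j) hj, polarTransform_apply]
      rw [splice, if_pos (Nat.lt_succ_self _), Function.update_self, Finset.prod_eq_one, mul_one]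
      exact fun k => k.elim0
    unfold prefixAverage
    simp only [e]
    exact Fintype.expect_const _
  simp only [key]
  refine (Fintype.expect_const _).trans ?_
  have : Unique (Fin (ℓ ^ 0)) := ⟨⟨i⟩, hone⟩
  refine Fintype.sum_equiv (Equiv.funUnique (Fin (ℓ ^ 0)) Y) _ _ fun y => ?_
  exact congrArg (fun j => φ (W 0 (y j)) (W 1 (y j))) (hone _).symm

end Recursion

/-! ### Product weights -/

section ProductWeights

variable {ι Y : Type*} [Fintype ι] [DecidableEq ι] [Fintype Y]

lemma sum_prod_erase_mul (g : ι → Y → ℝ) (k : ι) (hg : ∀ j, j ≠ k → ∑ a, g j a = 1)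
    (f : Y → ℝ) :
    ∑ y : ι → Y, (∏ j ∈ Finset.univ.erase k, g j (y j)) * f (y k) = ∑ a, f a := by
  have h := Fintype.prod_sum (Function.update g k f)
  rw [← Finset.prod_erase_mul _ _ (Finset.mem_univ k), Function.update_self,
    Finset.prod_eq_one, one_mul] at h
  · rw [h]
    refine Finset.sum_congr rfl fun y _ => ?_
    rw [← Finset.prod_erase_mul _ _ (Finset.mem_univ k), Function.update_self]
    congr 1
    exact Finset.prod_congr rfl fun j hj => by rw [Function.update_of_ne (Finset.ne_of_mem_erase hj)]
  · intro j hj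
    rw [Function.update_of_ne (Finset.ne_of_mem_erase hj)]
    exact hg j (Finset.ne_of_mem_erase hj)

/-- If a factor vanishes, so does every term on both sides, since `0 * log 0 = 0`; otherwise the
logarithm splits. This gives additivity of entropy for product laws. -/
lemma prod_mul_logb_prod (g : ι → ℝ) :
    (∏ j, g j) * Real.logb 2 (∏ j, g j) =
      ∑ k, (∏ j ∈ Finset.univ.erase k, g j) * (g k * Real.logb 2 (g k)) := by
  by_cases h : ∃ j, g j = 0
  · obtain ⟨j, hj⟩ := h
    rw [Finset.prod_eq_zero (Finset.mem_univ j) hj, zero_mul, eq_comm]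
    refine Finset.sum_eq_zero fun k _ => ?_
    rcases eq_or_ne k j with rfl | hne
    · simp [hj]
    · rw [Finset.prod_eq_zero (Finset.mem_erase.2 ⟨hne.symm, Finset.mem_univ j⟩) hj, zero_mul]
  · push Not at h
    rw [Real.logb_prod _ _ fun j _ => h j, Finset.mul_sum]
    refine Finset.sum_congr rfl fun k _ => ?_
    rw [← mul_assoc, Finset.prod_erase_mul _ _ (Finset.mem_univ k)]

lemma sum_prod_mul_logb_prod (g : ι → Y → ℝ) (hg : ∀ j, ∑ a, g j a = 1) :
    ∑ y : ι → Y, (∏ j, g j (y j)) * Real.logb 2 (∏ j, g j (y j)) =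
      ∑ j, ∑ a, g j a * Real.logb 2 (g j a) := by
  simp only [prod_mul_logb_prod]
  rw [Finset.sum_comm]
  exact Finset.sum_congr rfl fun k _ => sum_prod_erase_mul g k (fun j _ => hg j)
    fun a => g k a * Real.logb 2 (g k a)

end ProductWeights

/-! ### The chain rule -/

section ChainRule

lemma infoKernel_eq_mul_logb {a b : ℝ} (ha : 0 ≤ a) (hb : 0 ≤ b) :
    infoKernel a b = (a * Real.logb 2 a + b * Real.logb 2 b) / 2 -
      (a + b) / 2 * Real.logb 2 ((a + b) / 2) := by
  -- The bound `x ≤ 2 * c` keeps `c` nonzero whenever `x` is positive.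
  have key : ∀ x c, 0 ≤ x → x ≤ 2 * c →
      x * Real.logb 2 (x / c) = x * Real.logb 2 x - x * Real.logb 2 c := by
    intro x c hx hc
    rcases hx.eq_or_lt with rfl | hx
    · simp
    rw [Real.logb_div hx.ne' (by linarith)]
    ring
  unfold infoKernel
  rw [show 1 / 2 * a + 1 / 2 * b = (a + b) / 2 by ring, mul_assoc, mul_assoc,
    key a _ ha (by linarith), key b _ hb (by linarith)]
  ring

variable {Y : Type*} {N : ℕ} {W : ZMod 2 → Y → ℝ} {M : Matrix (Fin N) (Fin N) (ZMod 2)}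

lemma expect_update (i : Fin N) (h : (Fin N → ZMod 2) → ℝ) :
    𝔼 u, (h (Function.update u i 0) + h (Function.update u i 1)) / 2 = 𝔼 u, h u := by
  have h1 : ∀ u, (h (Function.update u i 0) + h (Function.update u i 1)) / 2 =
      𝔼 x, h (Function.update u i x) := fun u =>
    (Finset.expect_zmod_two fun x => h (Function.update u i x)).symm
  simp only [h1]
  rw [← Finset.expect_product' Finset.univ Finset.univ fun u x => h (Function.update u i x),
    Finset.univ_product_univ]
  refine Finset.expect_comp_of_surjective_add
    (fun q : (Fin N → ZMod 2) × ZMod 2 => Function.update q.1 i q.2) ?_ ?_ h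
  · rintro ⟨u, x⟩ ⟨u', x'⟩
    exact Function.update_add u u' i x x'
  · intro u
    exact ⟨(u, u i), Function.update_eq_self i u⟩

/-- Averaging over bit `i` moves it from the prefix to the uniform suffix. -/
lemma prefixAverage_eq_half (i : Fin N) (u : Fin N → ZMod 2) (y : Fin N → Y) :
    (prefixAverage W M (i + 1) (Function.update u i 0) y +
      prefixAverage W M (i + 1) (Function.update u i 1) y) / 2 = prefixAverage W M i u y := by
  unfold prefixAverage
  rw [← Finset.expect_add_distrib, Finset.expect_div,
    ← expect_update i fun w => vectorChannel W M (splice i u w) y]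
  have e : ∀ (x : ZMod 2) w, splice (i + 1) (Function.update u i x) w =
      splice i u (Function.update w i x) := by
    intro x w
    funext j
    unfold splice
    rcases lt_trichotomy j i with h | rfl | h
    · rw [if_pos (Nat.lt_succ_of_lt h), if_pos (Fin.lt_def.1 h), Function.update_of_ne h.ne]
    · simp
    · have h1 := Fin.lt_def.1 h
      rw [if_neg (by omega), if_neg (by omega), Function.update_of_ne h.ne']
  simp only [e]

lemma expect_vecMul (hM : IsUnit M) (h : (Fin N → ZMod 2) → ℝ) :
    𝔼 u, h (u ᵥ* M) = 𝔼 u, h u := by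
  refine Finset.expect_comp_of_surjective_add (fun u : Fin N → ZMod 2 => u ᵥ* M)
    (fun a b => Matrix.add_vecMul _ _ _) (fun v => ⟨v ᵥ* M⁻¹, ?_⟩) h
  have hM' : IsUnit M.det := (Matrix.isUnit_iff_isUnit_det M).1 hM
  simp only [Matrix.vecMul_vecMul, Matrix.nonsing_inv_mul _ hM', Matrix.vecMul_one]

lemma prefixAverage_zero (hM : IsUnit M) (u : Fin N → ZMod 2) (y : Fin N → Y) :
    prefixAverage W M 0 u y = ∏ j, (W 0 (y j) + W 1 (y j)) / 2 := by
  have e : ∀ w : Fin N → ZMod 2, splice 0 u w = w := fun w => by funext j; simp [splice]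
  simp only [prefixAverage, e]
  refine (expect_vecMul hM fun x => ∏ j, W (x j) (y j)).trans ?_
  rw [← Finset.prod_expect_eq_expect_prod fun j x => W x (y j)]
  simp only [Finset.expect_zmod_two]

lemma prefixAverage_self (u : Fin N → ZMod 2) (y : Fin N → Y) :
    prefixAverage W M N u y = vectorChannel W M u y := by
  have e : ∀ w : Fin N → ZMod 2, splice N u w = u := fun w => by funext j; simp [splice]
  simp only [prefixAverage, e]
  exact Fintype.expect_const _

variable [Fintype Y]

lemma IsBDMC.mutualInfo_eq_entropy (hW : IsBDMC W) :
    mutualInfo W = (∑ a, W 0 a * Real.logb 2 (W 0 a) + ∑ a, W 1 a * Real.logb 2 (W 1 a)) / 2 -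
      ∑ a, (W 0 a + W 1 a) / 2 * Real.logb 2 ((W 0 a + W 1 a) / 2) := by
  rw [mutualInfo_eq_channelSum, ← Finset.sum_add_distrib, Finset.sum_div,
    ← Finset.sum_sub_distrib]
  exact Finset.sum_congr rfl fun a _ => infoKernel_eq_mul_logb (hW.nonneg 0 a) (hW.nonneg 1 a)

/-- The averages on the right are negative conditional entropies of the output given the first `i +
1` and the first `i` bits, so their differences telescope over `i`. -/
lemma mutualInfo_synthChannel (hW : IsBDMC W) (i : Fin N) :
    mutualInfo (synthChannel W M i) =
      𝔼 u, ∑ y, prefixAverage W M (i + 1) u y * Real.logb 2 (prefixAverage W M (i + 1) u y) -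
      𝔼 u, ∑ y, prefixAverage W M i u y * Real.logb 2 (prefixAverage W M i u y) := by
  rw [mutualInfo_eq_channelSum, channelSum_synthChannel isKernel_infoKernel hW.nonneg,
    ← expect_update i fun u => ∑ y, prefixAverage W M (i + 1) u y *
      Real.logb 2 (prefixAverage W M (i + 1) u y), ← Finset.expect_sub_distrib]
  refine Finset.expect_congr rfl fun u _ => ?_
  rw [← Finset.sum_add_distrib, Finset.sum_div, ← Finset.sum_sub_distrib]
  refine Finset.sum_congr rfl fun y _ => ?_
  rw [infoKernel_eq_mul_logb (prefixAverage_nonneg hW.nonneg _ _ _)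
    (prefixAverage_nonneg hW.nonneg _ _ _), prefixAverage_eq_half]

/-- The chain rule: an invertible transform preserves the total mutual information. -/
lemma sum_mutualInfo_synthChannel (hW : IsBDMC W) (hM : IsUnit M) :
    ∑ i, mutualInfo (synthChannel W M i) = N * mutualInfo W := by
  simp only [mutualInfo_synthChannel hW]
  set Λ : ℕ → ℝ := fun k =>
    𝔼 u, ∑ y, prefixAverage W M k u y * Real.logb 2 (prefixAverage W M k u y) with hΛ
  have hN : Λ N = N * ((∑ a, W 0 a * Real.logb 2 (W 0 a) +
      ∑ a, W 1 a * Real.logb 2 (W 1 a)) / 2) := by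
    have e : ∀ u, ∑ y, prefixAverage W M N u y * Real.logb 2 (prefixAverage W M N u y) =
        ∑ j, ∑ a, W ((u ᵥ* M) j) a * Real.logb 2 (W ((u ᵥ* M) j) a) := fun u => by
      simp only [prefixAverage_self, vectorChannel]
      exact sum_prod_mul_logb_prod (fun j a => W ((u ᵥ* M) j) a) fun j => hW.sum_eq_one _
    simp only [hΛ, e]
    refine (expect_vecMul hM fun x => ∑ j, ∑ a, W (x j) a * Real.logb 2 (W (x j) a)).trans ?_
    rw [Finset.expect_sum_comm]
    have e2 : ∀ j : Fin N, 𝔼 x : Fin N → ZMod 2, ∑ a, W (x j) a * Real.logb 2 (W (x j) a) =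
        (∑ a, W 0 a * Real.logb 2 (W 0 a) + ∑ a, W 1 a * Real.logb 2 (W 1 a)) / 2 := fun j =>
      (Finset.expect_comp_of_surjective_add (fun x : Fin N → ZMod 2 => x j) (fun _ _ => rfl)
        (Function.surjective_eval j) fun b => ∑ a, W b a * Real.logb 2 (W b a)).trans
          (Finset.expect_zmod_two _)
    simp [e2]
  have h0 : Λ 0 = N * ∑ a, (W 0 a + W 1 a) / 2 * Real.logb 2 ((W 0 a + W 1 a) / 2) := by
    have e : ∀ u, ∑ y, prefixAverage W M 0 u y * Real.logb 2 (prefixAverage W M 0 u y) =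
        N * ∑ a, (W 0 a + W 1 a) / 2 * Real.logb 2 ((W 0 a + W 1 a) / 2) := fun u => by
      simp only [prefixAverage_zero hM]
      refine (sum_prod_mul_logb_prod (fun (_ : Fin N) a => (W 0 a + W 1 a) / 2)
        fun j => hW.sum_half).trans ?_
      simp
    simp only [hΛ, e]
    exact Fintype.expect_const _
  have ht := Finset.sum_range_sub Λ N
  rw [← Fin.sum_univ_eq_sum_range (fun k => Λ (k + 1) - Λ k) N] at ht
  refine ht.trans ?_
  rw [hN, h0, hW.mutualInfo_eq_entropy]
  ring

end ChainRule

/-! ### Column permutations -/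

section Columns

variable {N : ℕ} {M : Matrix (Fin N) (Fin N) (ZMod 2)}

/-- The rows of `M` below row `i` are supported on the set `C` of columns, which has as many
elements as there are such rows. -/
structure IsLowerSupport (M : Matrix (Fin N) (Fin N) (ZMod 2)) (i : Fin N)
    (C : Finset (Fin N)) : Prop where
  card : C.card + i + 1 = N
  eq_zero : ∀ i', i < i' → ∀ j, j ∉ C → M i' j = 0

lemma card_image_Ioi {τ : Fin N → Fin N} (i : Fin N) (hτ : Set.InjOn τ {i' | i < i'}) :
    ((Finset.Ioi i).image τ).card + i + 1 = N := by
  rw [Finset.card_image_of_injOn (by simpa [Set.Ioi] using hτ), Fin.card_Ioi]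
  have := i.2
  omega

/-- Eliminating rows from the bottom either leads to a triangular form or stops at a row with two
ones outside the columns used so far. -/
lemma hasUpperTriangularColumnPerm_or_exists (M : Matrix (Fin N) (Fin N) (ZMod 2)) :
    HasUpperTriangularColumnPerm M ∨ ∃ i C, IsLowerSupport M i C ∧
      ∃ j₁ j₂, j₁ ≠ j₂ ∧ j₁ ∉ C ∧ j₂ ∉ C ∧ M i j₁ ≠ 0 ∧ M i j₂ ≠ 0 := by
  classical
  by_cases hbad : ∃ i C, IsLowerSupport M i C ∧
      ∃ j₁ j₂, j₁ ≠ j₂ ∧ j₁ ∉ C ∧ j₂ ∉ C ∧ M i j₁ ≠ 0 ∧ M i j₂ ≠ 0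
  · exact Or.inr hbad
  left
  -- `τ` assigns distinct columns to the last `k` rows; each of these rows vanishes outside its own
  -- column and those assigned to later rows.
  have key : ∀ k, k ≤ N → ∃ τ : Fin N → Fin N, Set.InjOn τ {i | N ≤ i + k} ∧
      ∀ i : Fin N, N ≤ i + k → ∀ j, j ≠ τ i → (∀ i', i < i' → τ i' ≠ j) → M i j = 0 := by
    intro k
    induction k with
    | zero =>
      intro _
      exact ⟨id, fun i hi => absurd i.2 (not_lt.2 hi), fun i hi => absurd i.2 (not_lt.2 hi)⟩
    | succ k ih =>
      intro hk
      obtain ⟨τ, hinj, hzero⟩ := ih (Nat.le_of_succ_le hk)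
      set i : Fin N := ⟨N - (k + 1), by omega⟩ with hi
      have hik : ∀ i' : Fin N, i < i' ↔ N ≤ i' + k := fun i' => by
        rw [Fin.lt_def]; simp only [hi]; omega
      set C := (Finset.Ioi i).image τ with hC
      have hCn : ∀ j, j ∉ C ↔ ∀ i', i < i' → τ i' ≠ j := fun j => by simp [hC]
      have hS : IsLowerSupport M i C :=
        ⟨card_image_Ioi i (by simpa only [hik] using hinj), fun i' hi' j hj =>
          hzero i' ((hik i').1 hi') j (fun h => (hCn j).1 hj i' hi' h.symm)
            fun i'' h'' => (hCn j).1 hj i'' (hi'.trans h'')⟩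
      -- Outside `C` row `i` has at most one nonzero entry, as `hbad` fails. If there is none, any
      -- unused column will do, since `C` is too small to exhaust them.
      have hex : ∃ j₀, j₀ ∉ C ∧ ∀ j, j ∉ C → j ≠ j₀ → M i j = 0 := by
        by_cases h : ∃ j, j ∉ C ∧ M i j ≠ 0
        · obtain ⟨j₀, hj₀, hne⟩ := h
          refine ⟨j₀, hj₀, fun j hj hjj => ?_⟩
          by_contra hMj
          exact hbad ⟨i, C, hS, j, j₀, hjj, hj, hj₀, hMj, hne⟩
        · push Not at h
          have hlt : C.card < (Finset.univ : Finset (Fin N)).card := by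
            have := hS.card
            rw [Finset.card_univ, Fintype.card_fin]
            omega
          obtain ⟨j₀, -, hj₀⟩ := Finset.exists_mem_notMem_of_card_lt_card hlt
          exact ⟨j₀, hj₀, fun j hj _ => h j hj⟩
      obtain ⟨j₀, hj₀, hj₀M⟩ := hex
      have hstep : ∀ i' : Fin N, N ≤ i' + (k + 1) → i' = i ∨ i < i' := fun i' h => by
        rcases eq_or_ne i' i with h' | h'
        · exact Or.inl h'
        · right
          rw [Fin.lt_def]
          have := Fin.val_ne_of_ne h'
          simp only [hi] at this ⊢
          omega
      refine ⟨Function.update τ i j₀, ?_, ?_⟩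
      · intro a ha b hb hab
        rcases hstep a ha with rfl | ha' <;> rcases hstep b hb with hb' | hb'
        · exact hb'.symm
        · rw [Function.update_self, Function.update_of_ne hb'.ne'] at hab
          exact absurd hab.symm ((hCn j₀).1 hj₀ b hb')
        · rw [hb', Function.update_self, Function.update_of_ne ha'.ne'] at hab
          exact absurd hab ((hCn j₀).1 hj₀ a ha')
        · rw [Function.update_of_ne hb'.ne', Function.update_of_ne ha'.ne'] at hab
          exact hinj ((hik a).1 ha') ((hik b).1 hb') hab
      · intro a ha j hj hj'
        have hup : ∀ i', i < i' → Function.update τ i j₀ i' = τ i' := fun i' h =>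
          Function.update_of_ne h.ne' _ _
        rcases hstep a ha with ha' | ha'
        · rw [ha'] at hj hj' ⊢
          rw [Function.update_self] at hj
          exact hj₀M j ((hCn j).2 fun i' h => hup i' h ▸ hj' i' h) hj
        · rw [hup a ha'] at hj
          exact hzero a ((hik a).1 ha') j hj fun i' h => hup i' (ha'.trans h) ▸ hj' i' h
  obtain ⟨τ, hinj, hzero⟩ := key N le_rfl
  have hinj' : Function.Injective τ := fun a b h =>
    hinj (Nat.le_add_left _ _) (Nat.le_add_left _ _) h
  refine ⟨Equiv.ofBijective τ (Finite.injective_iff_bijective.1 hinj'), fun a b hab => ?_⟩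
  exact hzero a (Nat.le_add_left _ _) (τ b) (fun h => hab.ne (hinj' h))
    fun i' h h' => (lt_trans hab h).ne' (hinj' h')

/-- In the triangular case row `i` has exactly one nonzero entry outside the columns used by the
rows below. -/
lemma HasUpperTriangularColumnPerm.exists_lowerSupport (hM : IsUnit M)
    (h : HasUpperTriangularColumnPerm M) (i : Fin N) :
    ∃ C, IsLowerSupport M i C ∧ ∃ j₀, j₀ ∉ C ∧ M i j₀ = 1 ∧ ∀ j, j ∉ C → j ≠ j₀ → M i j = 0 := by
  classical
  obtain ⟨σ, hσ⟩ := h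
  have hlow : ∀ a b : Fin N, b < a → M a (σ b) = 0 := fun a b hab => hσ hab
  have hdet : IsUnit (M.submatrix id σ).det := by
    have h1 : IsUnit M.det := (Matrix.isUnit_iff_isUnit_det M).1 hM
    rw [Matrix.det_permute']
    exact ((Equiv.Perm.sign σ).isUnit.map (Int.castRingHom (ZMod 2))).mul h1
  rw [Matrix.det_of_isUpperTriangular hσ] at hdet
  -- The determinant of the triangular form is the product of its diagonal.
  have hdiag : M i (σ i) ≠ 0 := (Finset.prod_ne_zero_iff.1 hdet.ne_zero) i (Finset.mem_univ i)
  have hone : ∀ x : ZMod 2, x ≠ 0 → x = 1 := by decide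
  refine ⟨(Finset.Ioi i).image σ, ⟨card_image_Ioi i σ.injective.injOn, ?_⟩, σ i, by simp,
    hone _ hdiag, ?_⟩
  · intro i' hi' j hj
    obtain ⟨j, rfl⟩ := σ.surjective j
    refine hlow i' j (lt_of_le_of_lt (not_lt.1 fun hlt => hj ?_) hi')
    exact Finset.mem_image_of_mem σ (Finset.mem_Ioi.2 hlt)
  · intro j hj hne
    obtain ⟨j, rfl⟩ := σ.surjective j
    refine hlow i j (lt_of_le_of_ne (not_lt.1 fun hlt => hj ?_) fun h => hne (h ▸ rfl))
    exact Finset.mem_image_of_mem σ (Finset.mem_Ioi.2 hlt)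

end Columns

/-! ### The one-step channels in product form -/

section ProductForm

variable {Y : Type*} {N : ℕ} {W : ZMod 2 → Y → ℝ} {M : Matrix (Fin N) (Fin N) (ZMod 2)}
  {i : Fin N} {C : Finset (Fin N)}

/-- The rows below `i` are independent, supported on `C` and as many as `C` has elements, so their
combinations restrict bijectively to all vectors on `C`. -/
lemma IsLowerSupport.surjective (hM : IsUnit M) (hC : IsLowerSupport M i C) :
    Function.Surjective fun (w : Fin N → ZMod 2) (j : C) => (splice (i + 1) 0 w ᵥ* M) j := by
  classical
  set E : ({j : Fin N // i < j} → ZMod 2) → Fin N → ZMod 2 :=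
    fun r j => if h : i < j then r ⟨j, h⟩ else 0 with hE
  have hout : ∀ r, ∀ j ∉ C, (E r ᵥ* M) j = 0 := by
    intro r j hj
    simp only [Matrix.vecMul, dotProduct]
    refine Finset.sum_eq_zero fun i' _ => ?_
    by_cases h : i < i'
    · rw [hC.eq_zero i' h j hj, mul_zero]
    · simp [hE, h]
  have hinj : Function.Injective fun r (j : C) => (E r ᵥ* M) j := by
    intro r r' h
    have h1 : E r ᵥ* M = E r' ᵥ* M := by
      funext j
      by_cases hj : j ∈ C
      · exact congrFun h ⟨j, hj⟩
      · rw [hout r j hj, hout r' j hj]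
    have h2 : E r = E r' := Matrix.vecMul_injective_of_isUnit hM h1
    funext j
    have := congrFun h2 j
    simpa [hE, j.2] using this
  have hcard : Fintype.card ({j : Fin N // i < j} → ZMod 2) = Fintype.card (C → ZMod 2) := by
    rw [Fintype.card_fun, Fintype.card_fun, Fintype.card_coe]
    have h1 : Fintype.card {j : Fin N // i < j} = (Finset.Ioi i).card :=
      Fintype.card_of_subtype _ fun j => by simp
    have := hC.card
    have := i.2
    rw [h1, Fin.card_Ioi]
    congr 1
    omega
  have hbij := (Fintype.bijective_iff_injective_and_card _).2 ⟨hinj, hcard⟩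
  intro z
  obtain ⟨r, hr⟩ := hbij.surjective z
  refine ⟨E r, ?_⟩
  have e : splice (i + 1) 0 (E r) = E r := by
    funext j
    unfold splice
    split_ifs with h
    · have : ¬ i < j := not_lt.2 (Fin.le_def.2 (Nat.lt_succ_iff.1 h))
      simp [hE, this]
    · rfl
  simp only [e]
  exact hr

/-- Uniform later bits make the symbols on `C` independent and uniform and do not touch the others,
so the average factors over the outputs. -/
lemma IsLowerSupport.prefixAverage_eq_prod (hM : IsUnit M) (hC : IsLowerSupport M i C)
    (u : Fin N → ZMod 2) (y : Fin N → Y) :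
    prefixAverage W M (i + 1) u y = ∏ j, if j ∈ C then (W 0 (y j) + W 1 (y j)) / 2
      else W ((splice (i + 1) u 0 ᵥ* M) j) (y j) := by
  classical
  have hsplit : ∀ w, splice (i + 1) u w ᵥ* M =
      splice (i + 1) u 0 ᵥ* M + splice (i + 1) 0 w ᵥ* M := by
    intro w
    rw [← Matrix.add_vecMul]
    congr 1
    funext j
    simp only [splice, Pi.add_apply]
    split_ifs <;> simp
  have hout : ∀ w, ∀ j ∉ C, (splice (i + 1) 0 w ᵥ* M) j = 0 := by
    intro w j hj
    simp only [Matrix.vecMul, dotProduct]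
    refine Finset.sum_eq_zero fun i' _ => ?_
    by_cases h : i < i'
    · rw [hC.eq_zero i' h j hj, mul_zero]
    · have : (i' : ℕ) < i + 1 := Nat.lt_succ_iff.2 (Fin.le_def.1 (not_lt.1 h))
      simp [splice, this]
  set c := splice (i + 1) u 0 ᵥ* M with hc
  have h1 : ∀ w, vectorChannel W M (splice (i + 1) u w) y =
      (∏ j : C, W (c j + (splice (i + 1) 0 w ᵥ* M) j) (y j)) *
        ∏ j : {j // j ∉ C}, W (c j) (y j) := by
    intro w
    unfold vectorChannel
    rw [hsplit, ← Fintype.prod_subtype_mul_prod_subtype (fun j => j ∈ C)]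
    congr 1
    · exact Finset.prod_congr (by ext; simp) fun j _ => rfl
    · refine Finset.prod_congr (by ext; simp) fun j _ => ?_
      rw [Pi.add_apply, hout w j j.2, add_zero]
  unfold prefixAverage
  simp only [h1]
  rw [← Finset.expect_mul, Finset.expect_comp_of_surjective_add
    (fun (w : Fin N → ZMod 2) (j : C) => (splice (i + 1) 0 w ᵥ* M) j) ?_ (hC.surjective hM)
    (fun z => ∏ j : C, W (c j + z j) (y j)),
    ← Finset.prod_expect_eq_expect_prod fun (j : C) b => W (c j + b) (y j),
    ← Fintype.prod_subtype_mul_prod_subtype (fun j => j ∈ C)]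
  · congr 1
    · refine Finset.prod_congr (by ext; simp) fun j _ => ?_
      rw [if_pos j.2, ← Finset.expect_zmod_two fun b => W b (y j)]
      exact Fintype.expect_equiv (Equiv.addLeft (c j)) _ _ fun b => rfl
    · exact Finset.prod_congr (by ext; simp) fun j _ => (if_neg j.2).symm
  · intro w w'
    funext j
    have : splice (i + 1) 0 (w + w') = splice (i + 1) 0 w + splice (i + 1) 0 w' := by
      funext j
      simp only [splice, Pi.add_apply]
      split_ifs <;> simp
    rw [this, Matrix.add_vecMul]
    rfl

lemma splice_update_vecMul (u : Fin N → ZMod 2) (x : ZMod 2) (j : Fin N) :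
    (splice (i + 1) (Function.update u i x) 0 ᵥ* M) j = (splice i u 0 ᵥ* M) j + x * M i j := by
  have e : splice (i + 1) (Function.update u i x) 0 = splice i u 0 + Pi.single i x := by
    funext j
    simp only [splice, Pi.add_apply]
    rcases lt_trichotomy j i with h | rfl | h
    · rw [if_pos (Nat.lt_succ_of_lt h), if_pos (Fin.lt_def.1 h), Function.update_of_ne h.ne,
        Pi.single_eq_of_ne h.ne, add_zero]
    · simp
    · have h1 := Fin.lt_def.1 h
      rw [if_neg (by omega), if_neg (by omega), Pi.single_eq_of_ne h.ne', add_zero]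
  rw [e, Matrix.add_vecMul, Pi.add_apply, Matrix.single_vecMul]
  rfl

lemma IsLowerSupport.prefixAverage_update (hM : IsUnit M) (hC : IsLowerSupport M i C)
    (u : Fin N → ZMod 2) (x : ZMod 2) (y : Fin N → Y) :
    prefixAverage W M (i + 1) (Function.update u i x) y =
      ∏ j, if j ∈ C then (W 0 (y j) + W 1 (y j)) / 2
        else W ((splice i u 0 ᵥ* M) j + x * M i j) (y j) := by
  rw [hC.prefixAverage_eq_prod hM]
  simp only [splice_update_vecMul]

variable [Fintype Y]

/-- The past bits shift the input by a known constant; this at most swaps the two arguments of the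
kernel. -/
lemma channelSum_shift {φ : ℝ → ℝ → ℝ} (hφ : IsKernel φ) (c : ZMod 2) :
    channelSum φ (fun x => W (c + x)) = channelSum φ W := by
  have h : c = 0 ∨ c = 1 := by revert c; decide
  rcases h with rfl | rfl
  · simp
  · unfold channelSum
    refine Finset.sum_congr rfl fun y _ => ?_
    exact hφ.symm _ _

lemma IsBDMC.shift (hW : IsBDMC W) (c : ZMod 2) : IsBDMC fun x => W (c + x) :=
  ⟨fun _ y => hW.nonneg _ y, fun _ => hW.sum_eq_one _⟩

lemma IsBDMC.sum_factor (hW : IsBDMC W) (j : Fin N) (b : ZMod 2) :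
    ∑ a, (if j ∈ C then (W 0 a + W 1 a) / 2 else W b a) = 1 := by
  split_ifs
  · exact hW.sum_half
  · exact hW.sum_eq_one b

lemma IsBDMC.factor_nonneg (hW : IsBDMC W) (j : Fin N) (b : ZMod 2) (a : Y) :
    0 ≤ (if j ∈ C then (W 0 a + W 1 a) / 2 else W b a) := by
  split_ifs
  · exact hW.half_nonneg a
  · exact hW.nonneg b a

/-- If only one output depends on the input bit, all channel parameters are preserved. -/
lemma IsLowerSupport.channelSum_synthChannel_eq {φ : ℝ → ℝ → ℝ} (hφ : IsKernel φ) (hW : IsBDMC W)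
    (hM : IsUnit M) (hC : IsLowerSupport M i C) {j₀ : Fin N} (hj₀ : j₀ ∉ C) (h1 : M i j₀ = 1)
    (h0 : ∀ j, j ∉ C → j ≠ j₀ → M i j = 0) :
    channelSum φ (synthChannel W M i) = channelSum φ W := by
  classical
  rw [channelSum_synthChannel hφ hW.nonneg]
  refine (Finset.expect_congr rfl fun u _ => ?_).trans (Fintype.expect_const _)
  set c := splice i u 0 ᵥ* M
  have e : ∀ x y, prefixAverage W M (i + 1) (Function.update u i x) y =
      (∏ j ∈ Finset.univ.erase j₀, if j ∈ C then (W 0 (y j) + W 1 (y j)) / 2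
        else W (c j) (y j)) * W (c j₀ + x) (y j₀) := by
    intro x y
    rw [hC.prefixAverage_update hM, ← Finset.prod_erase_mul _ _ (Finset.mem_univ j₀), if_neg hj₀,
      h1, mul_one]
    congr 1
    refine Finset.prod_congr rfl fun j hj => ?_
    split_ifs with hjC
    · rfl
    · rw [h0 j hjC (Finset.ne_of_mem_erase hj), mul_zero, add_zero]
  have e2 : ∀ y, φ (prefixAverage W M (i + 1) (Function.update u i 0) y)
      (prefixAverage W M (i + 1) (Function.update u i 1) y) =
      (∏ j ∈ Finset.univ.erase j₀, if j ∈ C then (W 0 (y j) + W 1 (y j)) / 2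
        else W (c j) (y j)) * φ (W (c j₀ + 0) (y j₀)) (W (c j₀ + 1) (y j₀)) := by
    intro y
    rw [e, e, hφ.homog _ _ _ (Finset.prod_nonneg fun j _ => hW.factor_nonneg j _ _)
      (hW.nonneg _ _) (hW.nonneg _ _)]
  rw [Finset.sum_congr rfl fun y _ => e2 y,
    sum_prod_erase_mul (fun j a => if j ∈ C then (W 0 a + W 1 a) / 2 else W (c j) a) j₀
      (fun j _ => hW.sum_factor j _) fun a => φ (W (c j₀ + 0) a) (W (c j₀ + 1) a)]
  exact channelSum_shift hφ (c j₀)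

lemma sum_filter_prod_eq {ι : Type*} [Fintype ι] [DecidableEq ι] [DecidableEq Y] (g : ι → Y → ℝ)
    (hg : ∀ j, ∑ a, g j a = 1) {k l : ι} (hkl : k ≠ l) (q : Y × Y) :
    ∑ y : ι → Y with (y k, y l) = q, ∏ j, g j (y j) = g k q.1 * g l q.2 := by
  have h : (Finset.univ.filter fun y : ι → Y => (y k, y l) = q) = Fintype.piFinset fun j =>
      if j = k then {q.1} else if j = l then {q.2} else Finset.univ := by
    ext y
    simp only [Finset.mem_filter, Finset.mem_univ, true_and, Fintype.mem_piFinset]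
    constructor
    · rintro rfl j
      split_ifs with h1 h2
      · simp [h1]
      · simp [h2]
      · simp
    · intro h
      have h1 := h k
      have h2 := h l
      rw [if_pos rfl, Finset.mem_singleton] at h1
      rw [if_neg hkl.symm, if_pos rfl, Finset.mem_singleton] at h2
      rw [h1, h2]
  rw [h, ← Finset.prod_univ_sum, Fintype.prod_eq_mul k l hkl]
  · simp [hkl.symm]
  · rintro j ⟨h1, h2⟩
    rw [if_neg h1, if_neg h2, hg]

/-- If two outputs depend on the input bit, the mutual information grows. -/
lemma IsLowerSupport.mutualInfo_synthChannel_ge (hW : IsBDMC W)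
    (hM : IsUnit M) (hC : IsLowerSupport M i C) {j₁ j₂ : Fin N} (hne : j₁ ≠ j₂) (hj₁ : j₁ ∉ C)
    (hj₂ : j₂ ∉ C) (h1 : M i j₁ ≠ 0) (h2 : M i j₂ ≠ 0) :
    mutualInfo W + meanSqBias W * (1 - meanSqBias W) ^ 2 / 8 ≤
      mutualInfo (synthChannel W M i) := by
  classical
  have hone : ∀ x : ZMod 2, x ≠ 0 → x = 1 := by decide
  rw [mutualInfo_eq_channelSum (synthChannel W M i),
    channelSum_synthChannel isKernel_infoKernel hW.nonneg]
  refine (Fintype.expect_const (ι := Fin N → ZMod 2) _).ge.trans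
    (Finset.expect_le_expect fun u _ => ?_)
  set c := splice i u 0 ᵥ* M
  have hgain := (hW.shift (c j₁)).mutualInfo_add_le (hW.shift (c j₂))
  have hs1 : mutualInfo (fun x => W (c j₁ + x)) = mutualInfo W := by
    rw [mutualInfo_eq_channelSum, channelSum_shift isKernel_infoKernel, mutualInfo_eq_channelSum]
  have hs2 : ∀ c, meanSqBias (fun x => W (c + x)) = meanSqBias W :=
    channelSum_shift isKernel_biasKernel
  rw [hs1, hs2, hs2] at hgain
  refine hgain.trans ?_
  rw [← Fintype.sum_prod_type' fun a b =>
    infoKernel (W (c j₁ + 0) a * W (c j₂ + 0) b) (W (c j₁ + 1) a * W (c j₂ + 1) b),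
    ← Finset.sum_fiberwise Finset.univ fun y : Fin N → Y => (y j₁, y j₂)]
  refine Finset.sum_le_sum fun q _ => ?_
  -- Discarding all outputs except those at `j₁` and `j₂` leaves two independent looks at the bit,
  -- each with a known shift, and by data processing cannot raise the information.
  have e : ∀ x, ∑ y : Fin N → Y with (y j₁, y j₂) = q,
      prefixAverage W M (i + 1) (Function.update u i x) y = W (c j₁ + x) q.1 * W (c j₂ + x) q.2 := by
    intro x
    simp only [hC.prefixAverage_update hM]
    rw [sum_filter_prod_eq (fun j a => if j ∈ C then (W 0 a + W 1 a) / 2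
      else W (c j + x * M i j) a) (fun j => hW.sum_factor j _) hne, if_neg hj₁, if_neg hj₂,
      hone _ h1, hone _ h2, mul_one]
  rw [← e, ← e]
  exact infoKernel_sum_le _ _ _ (fun y _ => prefixAverage_nonneg hW.nonneg _ _ _)
    fun y _ => prefixAverage_nonneg hW.nonneg _ _ _

end ProductForm

/-! ### Polarizing matrices -/

section Polarizing

variable {Y : Type*} {N : ℕ} {W : ZMod 2 → Y → ℝ} {M : Matrix (Fin N) (Fin N) (ZMod 2)}
  {i : Fin N} {C : Finset (Fin N)}

lemma IsLowerSupport.zeroPastChannel_eq_prod (hM : IsUnit M) (hC : IsLowerSupport M i C)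
    (x : ZMod 2) (y : Fin N → Y) :
    zeroPastChannel W M i x y = ∏ j, if j ∈ C then (W 0 (y j) + W 1 (y j)) / 2
      else W (x * M i j) (y j) := by
  have e : splice (N := N) i 0 0 = 0 := by funext j; simp [splice]
  rw [zeroPastChannel_eq, hC.prefixAverage_update hM]
  simp only [e, Matrix.zero_vecMul, Pi.zero_apply, zero_add]

variable [Fintype Y]

lemma IsLowerSupport.isPolarizing (hW : IsBDMC W) (hM : IsUnit M) (hC : IsLowerSupport M i C)
    {j₁ j₂ : Fin N} (hne : j₁ ≠ j₂) (hj₁ : j₁ ∉ C) (hj₂ : j₂ ∉ C) (h1 : M i j₁ ≠ 0)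
    (h2 : M i j₂ ≠ 0) : IsPolarizing W M := by
  classical
  have hone : ∀ x : ZMod 2, x ≠ 0 → x = 1 := by decide
  -- Outputs outside `A` are either randomized, on `C`, or carry the symbol 0, since the past is
  -- zero.
  set A := Finset.univ.filter fun j => j ∉ C ∧ M i j ≠ 0 with hA
  refine ⟨i, A, fun z => ∏ j : {j // j ∉ A},
    if (j : Fin N) ∈ C then (W 0 (z j) + W 1 (z j)) / 2 else W 0 (z j), ?_, ?_, ?_, ?_⟩
  · exact Finset.one_lt_card.2 ⟨j₁, by simp [hA, hj₁, h1], j₂, by simp [hA, hj₂, h2], hne⟩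
  · exact fun z => Finset.prod_nonneg fun j _ => hW.factor_nonneg (j : Fin N) 0 (z j)
  · rw [← Fintype.prod_sum fun (j : {j // j ∉ A}) a =>
      if (j : Fin N) ∈ C then (W 0 a + W 1 a) / 2 else W 0 a]
    exact Finset.prod_eq_one fun j _ => hW.sum_factor (j : Fin N) 0
  · intro x y
    rw [hC.zeroPastChannel_eq_prod hM, ← Fintype.prod_subtype_mul_prod_subtype (fun j => j ∈ A),
      mul_comm, ← Finset.prod_coe_sort A]
    congr 1
    · refine Finset.prod_congr (by ext; simp) fun j _ => ?_
      have hj := j.2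
      simp only [hA, Finset.mem_filter, Finset.mem_univ, true_and, not_and, not_not] at hj
      split_ifs with h
      · rfl
      · rw [hj h, mul_zero]
    · refine Finset.prod_congr (by ext; simp) fun j _ => ?_
      have hj := j.2
      simp only [hA, Finset.mem_filter, Finset.mem_univ, true_and] at hj
      rw [if_neg hj.1, hone _ hj.2, mul_one]

lemma isPolarizing_of_not_hasUpperTriangularColumnPerm (hW : IsBDMC W) (hM : IsUnit M)
    (h : ¬ HasUpperTriangularColumnPerm M) : IsPolarizing W M := by
  obtain ⟨i, C, hC, j₁, j₂, hne, hj₁, hj₂, h1, h2⟩ :=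
    (hasUpperTriangularColumnPerm_or_exists M).resolve_left h
  exact hC.isPolarizing hW hM hne hj₁ hj₂ h1 h2

lemma IsBDMC.mutualInfo_eq_zero_of_eq (hW : IsBDMC W) (h : ∀ y, W 0 y = W 1 y) :
    mutualInfo W = 0 := by
  rw [mutualInfo_eq_channelSum]
  refine Finset.sum_eq_zero fun y _ => ?_
  rw [infoKernel_eq_mul_logb (hW.nonneg 0 y) (hW.nonneg 1 y), h y, add_self_div_two,
    add_self_div_two, sub_self]

/-- A triangular matrix can only be polarizing for a useless channel. -/
lemma IsPolarizing.not_hasUpperTriangularColumnPerm (hW : IsBDMC W) (hM : IsUnit M)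
    (hI : 0 < mutualInfo W) (hP : IsPolarizing W M) : ¬ HasUpperTriangularColumnPerm M := by
  classical
  intro hUT
  obtain ⟨i, A, Q, hA, -, hQ, hPQ⟩ := hP
  obtain ⟨C, hC, j₀, hj₀, -, h0⟩ := hUT.exists_lowerSupport hM i
  -- The law of output `k` is computed twice: it is `W x` by the polarizing form, as `k ∈ A`, and it
  -- is free of `x` by the triangular form, as `k ≠ j₀`. The function `f` reads off its value at
  -- `a`.
  obtain ⟨k, hkA, hk⟩ := Finset.exists_mem_ne (Finset.one_lt_card_iff_nontrivial.2
    (Finset.one_lt_card_iff_nontrivial.1 hA)) j₀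
  refine hI.ne' (hW.mutualInfo_eq_zero_of_eq fun a => ?_)
  set f : Y → ℝ := fun b => if b = a then 1 else 0 with hf
  have h1 : ∀ x, ∑ y : Fin N → Y, zeroPastChannel W M i x y * f (y k) = W x a := by
    intro x
    simp only [hPQ]
    rw [← (Equiv.piEquivPiSubtypeProd (fun j => j ∈ A) fun _ => Y).symm.sum_comp,
      Fintype.sum_prod_type_right]
    have hz : ∀ (z : {j // j ∉ A} → Y) (v : {j // j ∈ A} → Y), (fun j : {j // j ∉ A} =>
        (Equiv.piEquivPiSubtypeProd (fun j => j ∈ A) fun _ => Y).symm (v, z) j) = z := by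
      intro z v
      funext j
      simp [Equiv.piEquivPiSubtypeProd, j.2]
    have hv : ∀ (z : {j // j ∉ A} → Y) (v : {j // j ∈ A} → Y) (j : {j // j ∈ A}),
        (Equiv.piEquivPiSubtypeProd (fun j => j ∈ A) fun _ => Y).symm (v, z) j = v j := by
      intro z v j
      simp [Equiv.piEquivPiSubtypeProd]
    have e : ∀ (z : {j // j ∉ A} → Y) (v : {j // j ∈ A} → Y),
        Q (fun j => (Equiv.piEquivPiSubtypeProd (fun j => j ∈ A) fun _ => Y).symm (v, z) j) *
          (∏ j ∈ A, W x ((Equiv.piEquivPiSubtypeProd (fun j => j ∈ A) fun _ => Y).symm (v, z) j)) *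
          f ((Equiv.piEquivPiSubtypeProd (fun j => j ∈ A) fun _ => Y).symm (v, z) k) =
        Q z * ((∏ j ∈ Finset.univ.erase (⟨k, hkA⟩ : {j // j ∈ A}), W x (v j)) *
          (W x (v ⟨k, hkA⟩) * f (v ⟨k, hkA⟩))) := by
      intro z v
      rw [← mul_assoc (∏ j ∈ _, W x (v j)), Finset.prod_erase_mul _ (fun j => W x (v j))
        (Finset.mem_univ _), ← mul_assoc, ← Finset.prod_coe_sort A, hz,
        Finset.prod_congr rfl fun j _ => congrArg (W x) (hv z v j), hv z v ⟨k, hkA⟩]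
    simp only [e]
    simp only [← Finset.mul_sum]
    rw [← Finset.sum_mul, hQ, one_mul]
    refine (sum_prod_erase_mul (fun (_ : {j // j ∈ A}) => W x) ⟨k, hkA⟩
      (fun _ _ => hW.sum_eq_one x) fun b => W x b * f b).trans ?_
    simp [hf]
  have h3 : ∀ x, ∑ y : Fin N → Y, zeroPastChannel W M i x y * f (y k) =
      ∑ b, (if k ∈ C then (W 0 b + W 1 b) / 2 else W 0 b) * f b := by
    intro x
    have e : ∀ y : Fin N → Y, zeroPastChannel W M i x y * f (y k) =
        (∏ j ∈ Finset.univ.erase k, if j ∈ C then (W 0 (y j) + W 1 (y j)) / 2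
          else W (x * M i j) (y j)) *
          ((if k ∈ C then (W 0 (y k) + W 1 (y k)) / 2 else W 0 (y k)) * f (y k)) := by
      intro y
      rw [hC.zeroPastChannel_eq_prod hM, ← Finset.prod_erase_mul _ _ (Finset.mem_univ k), mul_assoc]
      congr 2
      split_ifs with hkC
      · rfl
      · rw [h0 k hkC hk, mul_zero]
    simp only [e]
    exact sum_prod_erase_mul (fun j b => if j ∈ C then (W 0 b + W 1 b) / 2
      else W (x * M i j) b) k (fun j _ => hW.sum_factor j _)
      fun b => (if k ∈ C then (W 0 b + W 1 b) / 2 else W 0 b) * f b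
  rw [← h1 0, ← h1 1, h3, h3]

end Polarizing

/-! ### Evolution of the channel parameters -/

section Evolution

variable {Y : Type*} [Fintype Y] {ℓ : ℕ} {W : ZMod 2 → Y → ℝ}
  {G : Matrix (Fin ℓ) (Fin ℓ) (ZMod 2)}

lemma polarI_zero (hW : IsBDMC W) (i : Fin (ℓ ^ 0)) : polarI W G 0 i = mutualInfo W := by
  rw [polarI, mutualInfo_eq_channelSum, channelSum_polarTransform_zero isKernel_infoKernel hW,
    mutualInfo_eq_channelSum]

lemma polarI_succ (hW : IsBDMC W) (hG : IsUnit G) (n : ℕ) (i : Fin (ℓ ^ n)) (r : Fin ℓ) :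
    polarI W G (n + 1) (appendLow ℓ n (i, r)) =
      mutualInfo (synthChannel (synthChannel W (polarTransform G n) i) G r) := by
  rw [polarI, mutualInfo_eq_channelSum, channelSum_polarTransform_succ isKernel_infoKernel hW hG,
    mutualInfo_eq_channelSum]

lemma channelSum_eq_of_hasUpperTriangularColumnPerm {φ : ℝ → ℝ → ℝ} (hφ : IsKernel φ)
    (hW : IsBDMC W) (hG : IsUnit G) (h : HasUpperTriangularColumnPerm G) (n : ℕ)
    (i : Fin (ℓ ^ n)) :
    channelSum φ (synthChannel W (polarTransform G n) i) = channelSum φ W := by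
  induction n with
  | zero => exact channelSum_polarTransform_zero hφ hW i
  | succ n ih =>
    obtain ⟨⟨i, r⟩, rfl⟩ := (appendLow ℓ n).surjective i
    obtain ⟨C, hC, j₀, hj₀, h1, h0⟩ := h.exists_lowerSupport hG r
    rw [channelSum_polarTransform_succ hφ hW hG,
      hC.channelSum_synthChannel_eq hφ (hW.synthChannel i) hG hj₀ h1 h0, ih]

lemma polarI_nonneg (hW : IsBDMC W) (n : ℕ) (i : Fin (ℓ ^ n)) : 0 ≤ polarI W G n i :=
  (hW.synthChannel i).mutualInfo_nonneg

lemma polarI_le_one (hW : IsBDMC W) (n : ℕ) (i : Fin (ℓ ^ n)) : polarI W G n i ≤ 1 :=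
  (hW.synthChannel i).mutualInfo_le_one

lemma sum_polarI_succ (hW : IsBDMC W) (hG : IsUnit G) (n : ℕ) (i : Fin (ℓ ^ n)) :
    ∑ r, polarI W G (n + 1) (appendLow ℓ n (i, r)) = ℓ * polarI W G n i := by
  simp only [polarI_succ hW hG]
  exact sum_mutualInfo_synthChannel (hW.synthChannel i) hG

lemma sum_polarI (hW : IsBDMC W) (hG : IsUnit G) (n : ℕ) :
    ∑ i, polarI W G n i = (ℓ : ℝ) ^ n * mutualInfo W := by
  induction n with
  | zero =>
    rw [Finset.sum_congr rfl fun i _ => polarI_zero hW i, Finset.sum_const, Finset.card_univ,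
      Fintype.card_fin]
    simp
  | succ n ih =>
    rw [← (appendLow ℓ n).sum_comp, Fintype.sum_prod_type]
    simp only [sum_polarI_succ hW hG]
    rw [← Finset.mul_sum, ih]
    ring

lemma card_subtype_eq_sum {ι : Type*} [Fintype ι] (p : ι → Prop) [DecidablePred p] :
    (Nat.card {i // p i} : ℝ) = ∑ i, if p i then 1 else 0 := by
  rw [Nat.card_eq_fintype_card, Fintype.card_subtype, Finset.sum_boole]

/-- The second moment of the mutual information grows with the fraction of undecided channels. -/
lemma sum_polarI_sq_succ_ge (hW : IsBDMC W) (hG : IsUnit G)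
    (hUT : ¬ HasUpperTriangularColumnPerm G) {ε : ℝ} (hε : 0 < ε) (n : ℕ) :
    ℓ * ∑ i, polarI W G n i ^ 2 + (ε ^ 5 / 256) ^ 2 *
        (Nat.card {i // polarI W G n i ∈ Set.Icc ε (1 - ε)} : ℝ) ≤
      ∑ i, polarI W G (n + 1) i ^ 2 := by
  classical
  obtain ⟨r₀, C, hC, j₁, j₂, hne, hj₁, hj₂, h1, h2⟩ :=
    (hasUpperTriangularColumnPerm_or_exists G).resolve_left hUT
  rw [card_subtype_eq_sum, ← (appendLow ℓ n).sum_comp fun i => polarI W G (n + 1) i ^ 2,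
    Fintype.sum_prod_type, Finset.mul_sum, Finset.mul_sum, ← Finset.sum_add_distrib]
  refine Finset.sum_le_sum fun i _ => ?_
  set a := polarI W G n i with ha
  -- By the chain rule `a` is the mean of its ℓ descendants, so the growth of the second moment is
  -- their variance; the row `r₀` alone already deviates enough.
  have hvar : ∑ r, (polarI W G (n + 1) (appendLow ℓ n (i, r)) - a) ^ 2 =
      ∑ r, polarI W G (n + 1) (appendLow ℓ n (i, r)) ^ 2 - ℓ * a ^ 2 := by
    simp only [sub_sq, Finset.sum_add_distrib, Finset.sum_sub_distrib]
    rw [← Finset.sum_mul, ← Finset.mul_sum, sum_polarI_succ hW hG]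
    simp only [Finset.sum_const, Finset.card_univ, Fintype.card_fin, nsmul_eq_mul]
    ring
  have hsingle : (polarI W G (n + 1) (appendLow ℓ n (i, r₀)) - a) ^ 2 ≤
      ∑ r, (polarI W G (n + 1) (appendLow ℓ n (i, r)) - a) ^ 2 :=
    Finset.single_le_sum (f := fun r => (polarI W G (n + 1) (appendLow ℓ n (i, r)) - a) ^ 2)
      (fun r _ => sq_nonneg _) (Finset.mem_univ r₀)
  have hmid : (ε ^ 5 / 256) ^ 2 * (if a ∈ Set.Icc ε (1 - ε) then 1 else 0) ≤
      (polarI W G (n + 1) (appendLow ℓ n (i, r₀)) - a) ^ 2 := by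
    split_ifs with hmem
    · rw [mul_one]
      have hV : IsBDMC (synthChannel W (polarTransform G n) i) := hW.synthChannel i
      have hge := hC.mutualInfo_synthChannel_ge hV hG hne hj₁ hj₂ h1 h2
      rw [← polarI_succ hW hG] at hge
      have hgain := hV.gain_lower_bound hε hmem.1 hmem.2
      refine pow_le_pow_left₀ (by positivity) ?_ 2
      have hV' : a = mutualInfo (synthChannel W (polarTransform G n) i) := rfl
      linarith
    · rw [mul_zero]
      exact sq_nonneg _
  linarith

/-- The normalized second moment `Q` is monotone and at most one, so its increments, which dominate
the undecided fraction up to a constant, tend to zero. -/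
lemma tendsto_card_undecided (hW : IsBDMC W) (hG : IsUnit G)
    (hUT : ¬ HasUpperTriangularColumnPerm G) (hℓ : 0 < ℓ) {ε : ℝ} (hε : 0 < ε) :
    Filter.Tendsto
      (fun n : ℕ => (Nat.card {i : Fin (ℓ ^ n) // polarI W G n i ∈ Set.Icc ε (1 - ε)} : ℝ)
        / (ℓ : ℝ) ^ n) Filter.atTop (nhds 0) := by
  set Q : ℕ → ℝ := fun n => (∑ i, polarI W G n i ^ 2) / (ℓ : ℝ) ^ n with hQ
  have hℓ' : (0 : ℝ) < ℓ := Nat.cast_pos.2 hℓ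
  set κ : ℝ := (ε ^ 5 / 256) ^ 2 with hκ
  have hκ0 : 0 < κ := by positivity
  have hstep : ∀ n, (Nat.card {i : Fin (ℓ ^ n) // polarI W G n i ∈ Set.Icc ε (1 - ε)} : ℝ)
      / (ℓ : ℝ) ^ n ≤ ℓ / κ * (Q (n + 1) - Q n) := by
    intro n
    have h := sum_polarI_sq_succ_ge hW hG hUT hε n
    rw [← hκ] at h
    simp only [hQ]
    rw [pow_succ (ℓ : ℝ)]
    have hp : (0 : ℝ) < (ℓ : ℝ) ^ n := by positivity
    field_simp
    linarith
  have hmono : Monotone Q := monotone_nat_of_le_succ fun n => by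
    have h1 := hstep n
    have h2 : 0 ≤ (Nat.card {i : Fin (ℓ ^ n) // polarI W G n i ∈ Set.Icc ε (1 - ε)} : ℝ)
      / (ℓ : ℝ) ^ n := by positivity
    have h3 := (mul_nonneg_iff_of_pos_left (div_pos hℓ' hκ0)).1 (h2.trans h1)
    linarith
  have hbdd : BddAbove (Set.range Q) := by
    refine ⟨1, ?_⟩
    rintro _ ⟨n, rfl⟩
    simp only [hQ]
    refine div_le_one_of_le₀ ?_ (by positivity)
    calc ∑ i, polarI W G n i ^ 2 ≤ ∑ i : Fin (ℓ ^ n), (1 : ℝ) :=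
          Finset.sum_le_sum fun i _ => pow_le_one₀ (polarI_nonneg hW n i) (polarI_le_one hW n i)
      _ = _ := by simp
  have hlim := tendsto_atTop_ciSup hmono hbdd
  have hdiff := ((hlim.comp (Filter.tendsto_add_atTop_nat 1)).sub hlim).const_mul (ℓ / κ)
  rw [sub_self, mul_zero] at hdiff
  exact squeeze_zero (fun n => by positivity) hstep hdiff

/-- If almost all channels are decided, any family of channels which contains the nearly noiseless
ones and excludes the nearly useless ones has limiting fraction `I(W)`. -/
lemma tendsto_card_of_decided (hW : IsBDMC W) (hG : IsUnit G) (hℓ : 0 < ℓ)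
    (hmid : ∀ ε : ℝ, 0 < ε → Filter.Tendsto
      (fun n : ℕ => (Nat.card {i : Fin (ℓ ^ n) // polarI W G n i ∈ Set.Icc ε (1 - ε)} : ℝ)
        / (ℓ : ℝ) ^ n) Filter.atTop (nhds 0))
    (S : ∀ n, Fin (ℓ ^ n) → Prop) {ε₀ : ℝ} (hε₀ : 0 < ε₀)
    (hS : ∀ n i, 1 - ε₀ < polarI W G n i → S n i)
    (hS' : ∀ n i, polarI W G n i < ε₀ → ¬ S n i) :
    Filter.Tendsto (fun n : ℕ => (Nat.card {i : Fin (ℓ ^ n) // S n i} : ℝ) / (ℓ : ℝ) ^ n)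
      Filter.atTop (nhds (mutualInfo W)) := by
  classical
  rw [Metric.tendsto_atTop]
  intro η hη
  set ε := min ε₀ (η / 2) with hε
  have hε0 : 0 < ε := lt_min hε₀ (half_pos hη)
  obtain ⟨n₀, hn₀⟩ := Metric.tendsto_atTop.1 (hmid ε hε0) (η / 2) (half_pos hη)
  refine ⟨n₀, fun n hn => ?_⟩
  have hp : (0 : ℝ) < (ℓ : ℝ) ^ n := pow_pos (Nat.cast_pos.2 hℓ) n
  have hm := hn₀ n hn
  rw [Real.dist_eq, sub_zero, abs_of_nonneg (by positivity), div_lt_iff₀ hp] at hm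
  -- Term by term, the indicator of `S` differs from the information by at most `ε` on decided
  -- channels and by at most one on the others.
  have hbound : |(Nat.card {i : Fin (ℓ ^ n) // S n i} : ℝ) - (ℓ : ℝ) ^ n * mutualInfo W| ≤
      (ℓ : ℝ) ^ n * ε +
        (Nat.card {i : Fin (ℓ ^ n) // polarI W G n i ∈ Set.Icc ε (1 - ε)} : ℝ) := by
    have hc : (ℓ : ℝ) ^ n * ε = ∑ _i : Fin (ℓ ^ n), ε := by simp
    rw [card_subtype_eq_sum, card_subtype_eq_sum, ← sum_polarI hW hG, hc,
      ← Finset.sum_sub_distrib, ← Finset.sum_add_distrib]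
    refine (Finset.abs_sum_le_sum_abs _ _).trans (Finset.sum_le_sum fun i _ => ?_)
    have h0 := polarI_nonneg (G := G) hW n i
    have h1 := polarI_le_one (G := G) hW n i
    by_cases hlow : polarI W G n i < ε
    · rw [if_neg (hS' n i (hlow.trans_le (min_le_left _ _))), zero_sub, abs_neg, abs_of_nonneg h0]
      have : (0 : ℝ) ≤ if polarI W G n i ∈ Set.Icc ε (1 - ε) then 1 else 0 := by
        split_ifs <;> norm_num
      linarith
    · by_cases hhigh : 1 - ε < polarI W G n i
      · have hSi : S n i := hS n i (by linarith [min_le_left ε₀ (η / 2)])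
        rw [if_pos hSi, abs_of_nonneg (by linarith)]
        have : (0 : ℝ) ≤ if polarI W G n i ∈ Set.Icc ε (1 - ε) then 1 else 0 := by
          split_ifs <;> norm_num
        linarith
      · rw [if_pos (show polarI W G n i ∈ Set.Icc ε (1 - ε) from ⟨not_lt.1 hlow, not_lt.1 hhigh⟩),
          abs_le]
        split_ifs <;> constructor <;> linarith
  rw [Real.dist_eq, div_sub' hp.ne', abs_div, abs_of_pos hp, div_lt_iff₀ hp]
  have := mul_le_mul_of_nonneg_left (min_le_right ε₀ (η / 2)) hp.le
  linarith

lemma tendsto_card_of_subset_undecided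
    (hmid : ∀ ε : ℝ, 0 < ε → Filter.Tendsto
      (fun n : ℕ => (Nat.card {i : Fin (ℓ ^ n) // polarI W G n i ∈ Set.Icc ε (1 - ε)} : ℝ)
        / (ℓ : ℝ) ^ n) Filter.atTop (nhds 0))
    (S : ∀ n, Fin (ℓ ^ n) → Prop) {ε : ℝ} (hε : 0 < ε)
    (hS : ∀ n i, S n i → polarI W G n i ∈ Set.Icc ε (1 - ε)) :
    Filter.Tendsto (fun n : ℕ => (Nat.card {i : Fin (ℓ ^ n) // S n i} : ℝ) / (ℓ : ℝ) ^ n)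
      Filter.atTop (nhds 0) := by
  refine squeeze_zero (fun n => by positivity) (fun n => ?_) (hmid ε hε)
  gcongr
  exact Nat.card_le_card_of_injective (Subtype.map id (hS n))
    (Subtype.map_injective _ Function.injective_id)

lemma polarZ_gt_of_polarI_lt (hW : IsBDMC W) {n : ℕ} {i : Fin (ℓ ^ n)} {ε : ℝ}
    (h : polarI W G n i < ε) : 1 - 4 * ε < polarZ W G n i := by
  have hV : IsBDMC (synthChannel W (polarTransform G n) i) := hW.synthChannel i
  have h1 := hV.meanSqBias_le
  have h2 := hV.one_sub_meanSqBias_le_bhattacharyya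
  rw [polarI] at h
  rw [polarZ]
  linarith

lemma polarZ_sq_lt_of_lt_polarI (hW : IsBDMC W) {n : ℕ} {i : Fin (ℓ ^ n)} {ε : ℝ}
    (h : 1 - ε < polarI W G n i) : polarZ W G n i ^ 2 < 2 * ε := by
  have hV : IsBDMC (synthChannel W (polarTransform G n) i) := hW.synthChannel i
  have h1 := hV.one_sub_meanSqBias_le
  have h2 := hV.bhattacharyya_sq_le
  rw [polarI] at h
  rw [polarZ]
  linarith

end Evolution

/-! ### Assembly of the theorem -/

theorem theorem1 {Y : Type*} [Fintype Y] (W : ZMod 2 → Y → ℝ)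
    (hW : IsBDMC W) (hsymm : IsSymmetricChannel W)
    {ℓ : ℕ} (G : Matrix (Fin ℓ) (Fin ℓ) (ZMod 2)) (hG : IsUnit G) :
    -- polarizing matrices and column permutations
    (¬ HasUpperTriangularColumnPerm G → IsPolarizing W G) ∧
    (0 < mutualInfo W → IsPolarizing W G → ¬ HasUpperTriangularColumnPerm G) ∧
    -- (i) polarization
    (IsPolarizing W G →
      (∀ δ : ℝ, 0 < δ →
        Filter.Tendsto
          (fun n : ℕ => (Nat.card {i : Fin (ℓ ^ n) // polarI W G n i ∈ Set.Ioo δ (1 - δ)} : ℝ)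
            / (ℓ : ℝ) ^ n) Filter.atTop (nhds 0) ∧
        Filter.Tendsto
          (fun n : ℕ => (Nat.card {i : Fin (ℓ ^ n) // polarZ W G n i ∈ Set.Ioo δ (1 - δ)} : ℝ)
            / (ℓ : ℝ) ^ n) Filter.atTop (nhds 0)) ∧
      -- the limiting fraction of noiseless channels
      (∀ δ : ℝ, 0 < δ → δ < 1 →
        Filter.Tendsto
          (fun n : ℕ => (Nat.card {i : Fin (ℓ ^ n) // 1 - δ ≤ polarI W G n i} : ℝ)
            / (ℓ : ℝ) ^ n) Filter.atTop (nhds (mutualInfo W)) ∧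
        Filter.Tendsto
          (fun n : ℕ => (Nat.card {i : Fin (ℓ ^ n) // polarZ W G n i ≤ δ} : ℝ)
            / (ℓ : ℝ) ^ n) Filter.atTop (nhds (mutualInfo W)))) ∧
    -- (ii) no change
    (¬ IsPolarizing W G ∨ HasUpperTriangularColumnPerm G →
      ∀ (n : ℕ) (i : Fin (ℓ ^ n)),
        polarI W G n i = mutualInfo W ∧ polarZ W G n i = bhattacharyya W) := by
  have hpol := isPolarizing_of_not_hasUpperTriangularColumnPerm hW hG
  have hconst : HasUpperTriangularColumnPerm G → ∀ (n : ℕ) (i : Fin (ℓ ^ n)),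
      polarI W G n i = mutualInfo W ∧ polarZ W G n i = bhattacharyya W := by
    intro hUT n i
    constructor
    · rw [polarI, mutualInfo_eq_channelSum, mutualInfo_eq_channelSum]
      exact channelSum_eq_of_hasUpperTriangularColumnPerm isKernel_infoKernel hW hG hUT n i
    · exact channelSum_eq_of_hasUpperTriangularColumnPerm isKernel_bhattKernel hW hG hUT n i
  refine ⟨hpol, fun hI hP => hP.not_hasUpperTriangularColumnPerm hW hG hI, fun hP => ?_, ?_⟩
  · have hℓ : 0 < ℓ := hP.choose.pos
    have hmid : ∀ ε : ℝ, 0 < ε → Filter.Tendsto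
        (fun n : ℕ => (Nat.card {i : Fin (ℓ ^ n) // polarI W G n i ∈ Set.Icc ε (1 - ε)} : ℝ)
          / (ℓ : ℝ) ^ n) Filter.atTop (nhds 0) := by
      intro ε hε
      -- A matrix that is both polarizing and triangular forces zero information, and then every
      -- channel stays at zero and none is undecided.
      by_cases hUT : HasUpperTriangularColumnPerm G
      · have hI : mutualInfo W = 0 := le_antisymm (not_lt.1 fun hI =>
          hP.not_hasUpperTriangularColumnPerm hW hG hI hUT) hW.mutualInfo_nonneg
        have hempty : ∀ n, IsEmpty {i : Fin (ℓ ^ n) // polarI W G n i ∈ Set.Icc ε (1 - ε)} :=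
          fun n => ⟨fun i => by
            have h1 := i.2.1
            rw [(hconst hUT n i).1, hI] at h1
            linarith⟩
        have h0 : ∀ n, Nat.card {i : Fin (ℓ ^ n) // polarI W G n i ∈ Set.Icc ε (1 - ε)} = 0 :=
          fun n => Nat.card_of_isEmpty
        simp only [h0, Nat.cast_zero, zero_div]
        exact tendsto_const_nhds
      · exact tendsto_card_undecided hW hG hUT hℓ hε
    refine ⟨fun δ hδ => ⟨?_, ?_⟩, fun δ hδ hδ1 => ⟨?_, ?_⟩⟩
    · exact tendsto_card_of_subset_undecided hmid _ hδ fun n i h => ⟨h.1.le, h.2.le⟩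
    -- Information below `δ / 4` puts the Bhattacharyya parameter above `1 - δ`; information above
    -- `1 - δ ^ 2 / 2` puts it below `δ`.
    · refine tendsto_card_of_subset_undecided hmid _
        (lt_min (show 0 < δ / 4 by positivity) (show 0 < δ ^ 2 / 2 by positivity))
        fun n i h => ⟨?_, ?_⟩
      · by_contra! hlt
        have := polarZ_gt_of_polarI_lt hW (hlt.trans_le (min_le_left _ _))
        linarith [h.2]
      · by_contra! hlt
        have h1 := polarZ_sq_lt_of_lt_polarI hW hlt
        have h2 := min_le_right (δ / 4) (δ ^ 2 / 2)
        have h3 := pow_lt_pow_left₀ h.1 hδ.le two_ne_zero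
        linarith
    · refine tendsto_card_of_decided hW hG hℓ hmid _ (lt_min hδ (sub_pos.2 hδ1))
        (fun n i h => ?_) fun n i h => ?_
      · linarith [min_le_left δ (1 - δ)]
      · linarith [min_le_right δ (1 - δ)]
    -- Here `(1 - δ) / 4` is chosen so that low information gives a Bhattacharyya parameter above
    -- `δ`.
    · refine tendsto_card_of_decided hW hG hℓ hmid _
        (lt_min (show 0 < (1 - δ) / 4 by linarith) (show 0 < δ ^ 2 / 2 by positivity))
        (fun n i h => ?_) fun n i h => ?_
      · have h1 := polarZ_sq_lt_of_lt_polarI hW h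
        have h2 := min_le_right ((1 - δ) / 4) (δ ^ 2 / 2)
        exact (lt_of_pow_lt_pow_left₀ 2 hδ.le (by linarith)).le
      · have := polarZ_gt_of_polarI_lt hW (h.trans_le (min_le_left _ _))
        linarith
  · rintro (hP | hUT)
    · exact hconst (not_not.1 fun h => hP (hpol h))
    · exact hconst hUT
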